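/- Fix an integer $d\ge 3$. A word over the alphabet $\{1,\dots,d\}$ is \emph{fully reducible} if the following stack is empty after reading the word from left to right: starting from the empty stack, each letter is popped against the top of the stack if it equals it, and is pushed otherwise. For $n\ge 0$ let $|\mathrm{PF}^{(d)}_{2n:2n}\rangle$ be the normalized uniform superposition of all fully reducible words of length $4n$, a pure state on $(\mathbb C^d)^{\otimes 4n}$. For $s\ge 1$ let $|\mathrm{D}^{(s)}_{2n:2n}\rangle$ be the normalized uniform superposition of all well-bracketed words of length $4n$ in brackets of $s$ colors, where every right bracket has the color of the left bracket that it closes ($s$-colored Dyck words); this is the ground state of the $s$-colored Fredkin spin chain. Let $S(\cdot)=-\sum_i\lambda_i^2\log_2\lambda_i^2$ be the entanglement entropy, in bits, across the cut into the first $2n$ and the last $2n$ sites, where the $\lambda_i$ are the Schmidt coefficients, counted with multiplicity. Then: 1. There is a constant $K=K(d)$ such that for all $n$ $$\Big(\frac{d-2}{d-1}\Big)^2 S\big(|\mathrm{D}^{(d-1)}_{2n:2n}\rangle\big)-K\;\le\; S\big(|\mathrm{PF}^{(d)}_{2n:2n}\rangle\big)\;\le\;\Big(\frac{d}{d-2}\Big)^2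 S\big(|\mathrm{D}^{(d-1)}_{2n:2n}\rangle\big)+K .$$ 2. For fixed $d$ and $n\to\infty$, $S\big(|\mathrm{PF}^{(d)}_{2n:2n}\rangle\big)=\Theta\big(S(|\mathrm{D}^{(d-1)}_{2n:2n}\rangle)\big)=\Theta(\sqrt n)$. 3. The Schmidt rank of $|\mathrm{PF}^{(d)}_{2n:2n}\rangle$ across this cut equals $1+\sum_{k=1}^{n}d(d-1)^{2k-1}$ for every $n\ge0$; in particular it is $\Theta\big((d-1)^{2n}\big)$ as $n\to\infty$, hence exponential in the chain length. -/

import Mathlib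

open Filter Asymptotics

namespace PairFlip

/-! ### Words and their reduction -/

/-- One step of the pushdown automaton of the pair-flip model (the head of the list is the top of the
stack): a letter equal to the top of the stack pops it, any other letter is pushed. -/
def pfStep {α : Type} [DecidableEq α] : List α → α → List α
  | [], a => [a]
  | b :: σ, a => if a = b then σ else a :: b :: σ

/-- The irreducible string of a word: the stack left after reading the word from left to right,
starting from the empty stack, read from bottom to top. -/
def irreducibleString {α : Type} [DecidableEq α] (w : List α) : List α :=
  (w.foldl pfStep []).reverse

/-- The fully reducible words of length `N` over the alphabet `{0, …, d - 1}`. -/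
def fullyReducibleWords (d N : ℕ) : Set (Fin N → Fin d) :=
  {w | irreducibleString (List.ofFn w) = []}

/-- Brackets of `s` colors: `Sum.inl c` is the left bracket and `Sum.inr c` the right bracket of
color `c`. -/
abbrev Bracket (s : ℕ) : Type := Fin s ⊕ Fin s

/-- One step of the bracket-matching automaton (the head of the list is the top of the stack of
currently open brackets, `none` is failure): a left bracket is pushed, a right bracket must close the
most recently opened bracket, which has to be of the same color. -/
def dyckStep {s : ℕ} : Option (List (Fin s)) → Bracket s → Option (List (Fin s))
  | none, _ => none
  | some σ, Sum.inl c => some (c :: σ)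
  | some [], Sum.inr _ => none
  | some (b :: σ), Sum.inr c => if c = b then some σ else none

/-- The well-bracketed words of length `N` with `s` colors of brackets (the `s`-colored Dyck paths
of length `N`). -/
def dyckWords (s N : ℕ) : Set (Fin N → Bracket s) :=
  {w | (List.ofFn w).foldl dyckStep (some []) = some []}

/-! ### Pure states of a chain and their bipartite entanglement

A (not necessarily normalized) pure state of a chain of `N` particles, whose local basis states are
labeled by the letters in `α`, is given by its amplitudes `(Fin N → α) → ℂ` in the product basis. -/

/-- The uniform superposition `|S|^(-1/2) ∑_{w ∈ S} |w⟩` of the words in `S`. -/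
noncomputable def uniformSuperposition {α : Type} {N : ℕ} (S : Set (Fin N → α)) :
    (Fin N → α) → ℂ :=
  S.indicator fun _ => (((Real.sqrt (S.ncard : ℝ))⁻¹ : ℝ) : ℂ)

/-- The matrix of amplitudes of a pure state of `a + b` particles with respect to the cut between the
first `a` and the last `b` of them. Its nonzero singular values are the Schmidt coefficients. -/
def cutMatrix {α : Type} (a b : ℕ) (ψ : (Fin (a + b) → α) → ℂ) :
    Matrix (Fin a → α) (Fin b → α) ℂ :=
  Matrix.of fun u v => ψ (Fin.append u v)

/-- The Schmidt rank of a pure state across a cut. -/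
noncomputable def schmidtRank {α : Type} [Fintype α] (a b : ℕ) (ψ : (Fin (a + b) → α) → ℂ) : ℕ :=
  (cutMatrix a b ψ).rank

/-- The entanglement entropy (in bits) of a pure state across a cut: `- ∑ p log₂ p` over the
eigenvalues `p` (with multiplicity) of the reduced density matrix of the first `a` particles, that is,
over the squares of the Schmidt coefficients. -/
noncomputable def entanglementEntropy {α : Type} [Fintype α] [DecidableEq α] (a b : ℕ)
    (ψ : (Fin (a + b) → α) → ℂ) : ℝ :=
  -∑ i, (Matrix.isHermitian_mul_conjTranspose_self (cutMatrix a b ψ)).eigenvalues i *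
      Real.logb 2
        ((Matrix.isHermitian_mul_conjTranspose_self (cutMatrix a b ψ)).eigenvalues i)

/-! ### The two states that are compared -/

/-- The uniform superposition of the fully reducible words with `d` letters on a chain of length
`4 n = 2 n + 2 n`. -/
noncomputable def pfState (d n : ℕ) : (Fin (2 * n + 2 * n) → Fin d) → ℂ :=
  uniformSuperposition (fullyReducibleWords d (2 * n + 2 * n))

/-- The uniform superposition of the `s`-colored Dyck words on a chain of length `4 n = 2 n + 2 n`
(the ground state of the `s`-colored Fredkin chain). -/
noncomputable def dyckState (s n : ℕ) : (Fin (2 * n + 2 * n) → Bracket s) → ℂ :=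
  uniformSuperposition (dyckWords s (2 * n + 2 * n))

/-- Half-chain entanglement entropy of the pair-flip state with `d` letters, chain length `4 n`. -/
noncomputable def pfEntropy (d n : ℕ) : ℝ :=
  entanglementEntropy (2 * n) (2 * n) (pfState d n)

/-- Half-chain entanglement entropy of the `s`-colored Dyck state, chain length `4 n`. -/
noncomputable def dyckEntropy (s n : ℕ) : ℝ :=
  entanglementEntropy (2 * n) (2 * n) (dyckState s n)

/-- Half-chain Schmidt rank of the pair-flip state with `d` letters, chain length `4 n`. -/
noncomputable def pfSchmidtRank (d n : ℕ) : ℕ :=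
  schmidtRank (2 * n) (2 * n) (pfState d n)

end PairFlip

/-!
Both states are uniform superpositions of words `u v` accepted by a stack automaton, and both
automata are reversible: `v` empties the stack left by `u` exactly when the mirror image of `v`
builds that same stack (`foldl_pfStep_eq_nil_iff`, `foldl_dyckStep_eq_nil_iff`). Hence the
amplitude matrix is constant on the blocks indexed by the stack at the cut, and there is one
squared Schmidt coefficient `A σ ^ 2 / Z` for each reachable stack `σ`, with `A σ` the number of
half-words that build `σ` (`sum_eigenvalues_blockMatrix`). This gives the Schmidt rank by counting
the reduced stacks of even height.

Write `s = d - 1`. The count `A σ` depends on the height `k` of `σ` only, through the recursion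
`stackCount`; for the two models it differs only at the empty stack, which can be entered from `s
+ 1` rather than `s` stacks. Consequently the pair-flip count at height `k` is the sum of the Dyck
counts at the heights `k, k + 2, k + 4, …` (`stackCount_succ_left`). The Dyck count at height `k =
2 i` is, up to a factor that does not depend on `i`, `s ^ (-i)` times the ballot number `Bᵢ = (2 i
+ 1) bᵢ`, so the rescaled pair-flip counts solve `aᵢ = Bᵢ + aᵢ₊₁ / s`. As `Bᵢ₊₁ ≤ Bᵢ (2 i + 3) /
(2 i + 1)`, this yields `Bᵢ + Bᵢ₊₁ / s ≤ aᵢ ≤ s / (s - 1) * (1 + O(1 / (i + 1))) * Bᵢ`.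

Grouping the stacks by height, each entropy is the mean height times `log₂ s`, up to `log₂ (n + 1)
+ 1` (`levelEntropy_bounds`). The mean height of the Dyck state is of order `√n`: summation by
parts relates the moments of `2 i + 1` under the weights `bᵢ ^ 2` to each other, and the
Cauchy–Schwarz inequality does the rest (`ballotMoment_ratio_bounds`). The bounds on `aᵢ` show
that the mean heights of the two models differ at most by factors strictly better than the claimed
ones (`meanHeight_pairFlip_le`, `le_meanHeight_pairFlip`). The gain, of order `√n`, absorbs the
logarithmic errors for all large `n`, and the constant `K` accounts for the remaining `n`.
-/

namespace PairFlip

/-! ### Schmidt coefficients of block-constant amplitude matrices -/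

open Polynomial in
/-- The spectrum of a Hermitian matrix `A * B` agrees with that of `B * A` up to zeros. -/
theorem sum_eigenvalues_of_mul_comm {U X R : Type*} [Fintype U] [DecidableEq U] [Fintype X]
    [DecidableEq X] [AddCommMonoid R] {M : Matrix U U ℂ} (hM : M.IsHermitian)
    (A : Matrix U X ℂ) (B : Matrix X U ℂ) (p : X → ℝ) (hAB : M = A * B)
    (hBA : B * A = Matrix.diagonal fun x => (p x : ℂ)) (h : ℝ → R) (h0 : h 0 = 0) :
    ∑ i, h (hM.eigenvalues i) = ∑ x, h (p x) := by
  have key := Matrix.charpoly_mul_comm' A B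
  rw [hBA, ← hAB] at key
  have hr := congrArg Polynomial.roots key
  have e1 : M.charpoly ≠ 0 := (Matrix.charpoly_monic M).ne_zero
  have e2 : (Matrix.diagonal fun x => (p x : ℂ)).charpoly ≠ 0 :=
    (Matrix.charpoly_monic _).ne_zero
  rw [roots_mul (mul_ne_zero (pow_ne_zero _ X_ne_zero) e1),
    roots_mul (mul_ne_zero (pow_ne_zero _ X_ne_zero) e2), roots_pow, roots_pow, roots_X,
    hM.roots_charpoly_eq_eigenvalues, Matrix.charpoly_diagonal,
    roots_prod _ _ (Finset.prod_ne_zero_iff.2 fun x _ => X_sub_C_ne_zero _)] at hr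
  have hs := congrArg (fun s : Multiset ℂ => (s.map fun z => h z.re).sum) hr
  simpa [Multiset.map_nsmul, Multiset.sum_nsmul, h0, roots_X_sub_C, Multiset.map_bind,
    Multiset.bind_singleton] using hs

/-- An amplitude matrix that is constant on the blocks `τ u = τ' v = σ`, `σ ∈ S`, and zero
elsewhere has one Schmidt coefficient for each `σ ∈ S`. -/
theorem sum_eigenvalues_blockMatrix {U V X R : Type*} [Fintype U] [DecidableEq U] [Fintype V]
    [DecidableEq X] [AddCommMonoid R] (C : Matrix U V ℂ) (S : Finset X) (τ : U → X) (τ' : V → X)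
    (c : ℝ) (hC : ∀ u v, C u v = if τ u = τ' v ∧ τ u ∈ S then (c : ℂ) else 0)
    (h : ℝ → R) (h0 : h 0 = 0) :
    ∑ i, h ((Matrix.isHermitian_mul_conjTranspose_self C).eigenvalues i) =
      ∑ σ ∈ S, h (c ^ 2 * (((Finset.univ.filter fun u => τ u = σ).card : ℝ) *
        ((Finset.univ.filter fun v => τ' v = σ).card : ℝ))) := by
  classical
  rw [← Finset.sum_coe_sort S]
  refine sum_eigenvalues_of_mul_comm _
    (Matrix.of fun u (σ : S) => if τ u = σ then (1 : ℂ) else 0)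
    (Matrix.of fun (σ : S) u => if τ u = σ then
      ((c ^ 2 * ((Finset.univ.filter fun v => τ' v = σ).card : ℝ) : ℝ) : ℂ) else 0)
    _ ?_ ?_ h h0
  · ext u u'
    have hl : (C * C.conjTranspose) u u' = ∑ v, if τ' v = τ u then
        (if τ u = τ u' ∧ τ u ∈ S then ((c : ℂ) ^ 2) else 0) else 0 := by
      rw [Matrix.mul_apply]
      refine Finset.sum_congr rfl fun v _ => ?_
      rw [Matrix.conjTranspose_apply, hC, hC]
      by_cases h1 : τ' v = τ u
      · by_cases h2 : τ u = τ u'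
        · by_cases h3 : τ u ∈ S
          · simp [h1, h2, h2 ▸ h3, pow_two]
          · simp [h1, h2, h2 ▸ h3]
        · have h4 : ¬τ u' = τ u := fun e => h2 e.symm
          simp [h1, h2, h4]
      · have h4 : ¬τ u = τ' v := fun e => h1 e.symm
        simp [h1, h4]
    rw [hl, ← Finset.sum_filter, Finset.sum_const, Matrix.mul_apply]
    simp only [Matrix.of_apply, ite_mul, one_mul, zero_mul]
    by_cases hu : τ u ∈ S
    · rw [Finset.sum_eq_single (⟨τ u, hu⟩ : S)]
      · by_cases huu : τ u = τ u'
        · simp [huu, huu ▸ hu, mul_comm]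
        · have h4 : ¬τ u' = τ u := fun e => huu e.symm
          simp [huu, h4]
      · rintro σ - hσ
        rw [if_neg]
        rintro e
        exact hσ (Subtype.ext e.symm)
      · simp
    · rw [Finset.sum_eq_zero]
      · simp [hu]
      · rintro σ -
        rw [if_neg]
        rintro e
        exact hu (e ▸ σ.2)
  · ext σ σ'
    rw [Matrix.mul_apply, Matrix.diagonal_apply]
    simp only [Matrix.of_apply, mul_ite, mul_one, mul_zero]
    by_cases hs : σ = σ'
    · subst hs
      simp only [if_true]
      rw [show (∑ x, if τ x = ↑σ then if τ x = ↑σ then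
        ((c ^ 2 * ((Finset.univ.filter fun v => τ' v = σ).card : ℝ) : ℝ) : ℂ) else 0 else 0)
        = ∑ x, if τ x = ↑σ then
        ((c ^ 2 * ((Finset.univ.filter fun v => τ' v = σ).card : ℝ) : ℝ) : ℂ) else 0 from
        Finset.sum_congr rfl fun x _ => by split_ifs <;> rfl, ← Finset.sum_filter,
        Finset.sum_const]
      push_cast
      simp only [nsmul_eq_mul]
      ring
    · rw [if_neg hs]
      refine Finset.sum_eq_zero fun u _ => ?_
      split_ifs with h1 h2
      · exact absurd (Subtype.ext (h2.symm.trans h1)) hs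
      · rfl
      · rfl

theorem cutMatrix_uniformSuperposition {α X : Type} [DecidableEq X] {a b : ℕ}
    (T : Set (Fin (a + b) → α)) (S : Finset X) (τ : (Fin a → α) → X) (τ' : (Fin b → α) → X)
    (hT : ∀ u v, Fin.append u v ∈ T ↔ τ u = τ' v ∧ τ u ∈ S) (u : Fin a → α) (v : Fin b → α) :
    cutMatrix a b (uniformSuperposition T) u v =
      if τ u = τ' v ∧ τ u ∈ S then (((Real.sqrt (T.ncard : ℝ))⁻¹ : ℝ) : ℂ) else 0 := by
  classical
  simp only [cutMatrix, uniformSuperposition, Matrix.of_apply, Set.indicator_apply, hT]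

section Superposition

variable {α X : Type} [Fintype α] [DecidableEq X] {a b : ℕ}

/-- The number of words of length `a` that a labeling `τ` sends to `σ`. -/
def labelCount (τ : (Fin a → α) → X) (σ : X) : ℕ :=
  (Finset.univ.filter fun u => τ u = σ).card

variable (T : Set (Fin (a + b) → α)) (S : Finset X) (τ : (Fin a → α) → X) (τ' : (Fin b → α) → X)

theorem ncard_eq_sum_labelCount
    (hT : ∀ u v, Fin.append u v ∈ T ↔ τ u = τ' v ∧ τ u ∈ S) :
    T.ncard = ∑ σ ∈ S, labelCount τ σ * labelCount τ' σ := by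
  classical
  have h1 : T.ncard = (Finset.univ.filter fun p : (Fin a → α) × (Fin b → α) =>
      τ p.1 = τ' p.2 ∧ τ p.1 ∈ S).card := by
    rw [← Set.ncard_coe_finset]
    symm
    refine Set.ncard_congr (fun p _ => Fin.append p.1 p.2) ?_ ?_ ?_
    · intro p hp
      exact (hT _ _).2 (by simpa using hp)
    · intro p q _ _ hpq
      exact (Fin.appendEquiv a b).injective hpq
    · intro w hw
      obtain ⟨p, rfl⟩ := (Fin.appendEquiv a b).surjective w
      exact ⟨p, by simpa using (hT _ _).1 hw, rfl⟩
  rw [h1, Finset.card_eq_sum_card_fiberwise (f := fun p => τ p.1) (t := S)]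
  · refine Finset.sum_congr rfl fun σ hσ => ?_
    rw [labelCount, labelCount, ← Finset.card_product]
    congr 1
    ext ⟨u, v⟩
    simp only [Finset.mem_filter, Finset.mem_univ, true_and, Finset.mem_product]
    constructor
    · rintro ⟨⟨h1, h2⟩, h3⟩
      exact ⟨h3, h1.symm.trans h3⟩
    · rintro ⟨h1, h2⟩
      exact ⟨⟨h1.trans h2.symm, h1 ▸ hσ⟩, h1⟩
  · intro p hp
    simp only [Finset.coe_filter, Set.mem_ofPred_eq] at hp
    exact hp.2.2

theorem entanglementEntropy_uniformSuperposition [DecidableEq α]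
    (hT : ∀ u v, Fin.append u v ∈ T ↔ τ u = τ' v ∧ τ u ∈ S) :
    entanglementEntropy a b (uniformSuperposition T) =
      -∑ σ ∈ S, (labelCount τ σ * labelCount τ' σ / T.ncard : ℝ) *
        Real.logb 2 (labelCount τ σ * labelCount τ' σ / T.ncard : ℝ) := by
  rw [entanglementEntropy, sum_eigenvalues_blockMatrix _ S τ τ' _
    (cutMatrix_uniformSuperposition T S τ τ' hT) (fun x => x * Real.logb 2 x) (by simp)]
  have : ((Real.sqrt (T.ncard : ℝ))⁻¹) ^ 2 = (T.ncard : ℝ)⁻¹ := by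
    rw [inv_pow, Real.sq_sqrt (Nat.cast_nonneg _)]
  simp only [this, labelCount, div_eq_inv_mul]

open scoped ComplexOrder in
theorem schmidtRank_uniformSuperposition
    (hT : ∀ u v, Fin.append u v ∈ T ↔ τ u = τ' v ∧ τ u ∈ S)
    (hpos : ∀ σ ∈ S, 0 < labelCount τ σ) (hpos' : ∀ σ ∈ S, 0 < labelCount τ' σ) :
    schmidtRank a b (uniformSuperposition T) = S.card := by
  classical
  rw [schmidtRank, ← Matrix.rank_self_mul_conjTranspose,
    (Matrix.isHermitian_mul_conjTranspose_self _).rank_eq_card_non_zero_eigs,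
    Fintype.card_subtype, Finset.card_filter]
  rw [sum_eigenvalues_blockMatrix _ S τ τ' _
    (cutMatrix_uniformSuperposition T S τ τ' hT) (fun x => if x ≠ 0 then 1 else 0) (by simp),
    Finset.card_eq_sum_ones]
  refine Finset.sum_congr rfl fun σ hσ => if_pos ?_
  have hN : 0 < T.ncard := by
    rw [ncard_eq_sum_labelCount T S τ τ' hT]
    exact Finset.sum_pos (fun σ hσ => Nat.mul_pos (hpos σ hσ) (hpos' σ hσ)) ⟨σ, hσ⟩
  have h1 := hpos σ hσ
  have h2 := hpos' σ hσ
  rw [labelCount] at h1 h2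
  positivity

end Superposition

/-! ### Counting words by their final stack -/

theorem labelCount_comp_equiv {α X : Type} [Fintype α] [DecidableEq X] {a : ℕ}
    (e : (Fin a → α) ≃ (Fin a → α)) (τ : (Fin a → α) → X) (σ : X) :
    labelCount (fun w => τ (e w)) σ = labelCount τ σ := by
  unfold labelCount
  rw [Finset.card_filter, Finset.card_filter]
  exact Equiv.sum_comp e fun w => if τ w = σ then 1 else 0

theorem labelCount_foldl_succ {α X : Type} [Fintype α] [DecidableEq X] (step : X → α → X) (x₀ : X)
    (N : ℕ) (σ : X) :
    labelCount (fun w : Fin (N + 1) → α => (List.ofFn w).foldl step x₀) σ =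
      ∑ a, (Finset.univ.filter fun w : Fin N → α =>
        step ((List.ofFn w).foldl step x₀) a = σ).card := by
  unfold labelCount
  simp only [Finset.card_filter]
  rw [← Equiv.sum_comp (Fin.snocEquiv fun _ => α), Fintype.sum_prod_type]
  refine Finset.sum_congr rfl fun a _ => Finset.sum_congr rfl fun w _ => ?_
  rw [List.ofFn_succ']
  simp [Fin.snocEquiv]

/-- The number of words of length `N` after which a stack automaton holds a given stack of height
`k`, if every stack can be entered by popping one of `s` letters and, when nonempty, by pushing
its top; the empty stack can be entered by popping one of `r` letters. -/
def stackCount (r s : ℕ) : ℕ → ℕ → ℕ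
  | 0, 0 => 1
  | 0, _ + 1 => 0
  | N + 1, 0 => r * stackCount r s N 1
  | N + 1, k + 1 => stackCount r s N k + s * stackCount r s N (k + 2)

theorem exists_of_stackCount_ne_zero {r s : ℕ} : ∀ {N k : ℕ}, stackCount r s N k ≠ 0 →
    ∃ j, N = k + 2 * j
  | 0, 0, _ => ⟨0, rfl⟩
  | 0, _ + 1, h => absurd rfl h
  | N + 1, 0, h => by
    obtain ⟨j, hj⟩ := exists_of_stackCount_ne_zero (right_ne_zero_of_mul h)
    exact ⟨j + 1, by omega⟩
  | N + 1, k + 1, h => by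
    rw [stackCount] at h
    by_cases h1 : stackCount r s N k = 0
    · rw [h1, zero_add] at h
      obtain ⟨j, hj⟩ := exists_of_stackCount_ne_zero (right_ne_zero_of_mul h)
      exact ⟨j + 1, by omega⟩
    · obtain ⟨j, hj⟩ := exists_of_stackCount_ne_zero h1
      exact ⟨j, by omega⟩

theorem stackCount_pos {r s : ℕ} (hr : 0 < r) (hs : 0 < s) :
    ∀ N k j : ℕ, N = k + 2 * j → 0 < stackCount r s N k
  | 0, 0, _, _ => Nat.one_pos
  | 0, k + 1, j, h => by omega
  | N + 1, 0, j, h => Nat.mul_pos hr (stackCount_pos hr hs N 1 (j - 1) (by omega))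
  | N + 1, k + 1, j, h => Nat.add_pos_left (stackCount_pos hr hs N k j (by omega)) _

/-- Allowing `s + 1` instead of `s` letters to empty the stack adds to the count at height `k` the
counts at the heights `k + 2, k + 4, …`. -/
theorem stackCount_succ_left (s : ℕ) : ∀ N k : ℕ,
    stackCount (s + 1) s N k = stackCount s s N k + stackCount (s + 1) s N (k + 2)
  | 0, 0 => rfl
  | 0, _ + 1 => rfl
  | N + 1, 0 => by
    have h := stackCount_succ_left s N 1
    simp only [stackCount]
    rw [h]
    ring
  | N + 1, k + 1 => by
    have h1 := stackCount_succ_left s N k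
    have h2 := stackCount_succ_left s N (k + 2)
    simp only [stackCount]
    rw [h1, h2]
    ring

/-- The ballot theorem, with `s` colors for each of the `j` letters that are popped. -/
theorem stackCount_self_eq (s : ℕ) : ∀ N k j : ℕ, N = k + 2 * j →
    (stackCount s s N k : ℝ) =
      s ^ j * (k + 1) * (N.factorial / (j.factorial * (k + j + 1).factorial))
  | 0, 0, j, h => by
    obtain rfl : j = 0 := by omega
    simp [stackCount]
  | 0, k + 1, j, h => by omega
  | N + 1, 0, 0, h => by omega
  | N + 1, 0, j + 1, h => by
    have ih := stackCount_self_eq s N 1 j (by omega)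
    rw [stackCount, Nat.cast_mul, ih]
    have hN : (N : ℝ) = 2 * j + 1 := by
      have : N = 2 * j + 1 := by omega
      exact_mod_cast this
    rw [show 0 + (j + 1) + 1 = 1 + j + 1 by ring, Nat.factorial_succ N, Nat.factorial_succ j]
    have h1 := Nat.factorial_pos j
    have h2 := Nat.factorial_pos (1 + j + 1)
    push_cast
    rw [hN]
    field_simp
    ring
  | N + 1, k + 1, 0, h => by
    have ih := stackCount_self_eq s N k 0 (by omega)
    have h0 : stackCount s s N (k + 2) = 0 := by
      by_contra h1
      obtain ⟨j, hj⟩ := exists_of_stackCount_ne_zero h1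
      omega
    obtain rfl : N = k := by omega
    rw [stackCount, h0, mul_zero, add_zero, ih]
    rw [show N + 1 + 0 + 1 = N + 1 + 1 by ring, show N + 0 + 1 = N + 1 by ring,
      Nat.factorial_succ (N + 1), Nat.factorial_succ N]
    have h1 := Nat.factorial_pos N
    push_cast
    field_simp
  | N + 1, k + 1, j + 1, h => by
    have ih1 := stackCount_self_eq s N k (j + 1) (by omega)
    have ih2 := stackCount_self_eq s N (k + 2) j (by omega)
    rw [stackCount, Nat.cast_add, Nat.cast_mul, ih1, ih2]
    have hN : (N : ℝ) = k + 2 * j + 2 := by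
      have : N = k + 2 * j + 2 := by omega
      exact_mod_cast this
    rw [show k + 1 + (j + 1) + 1 = (k + j + 2) + 1 by ring,
      show k + 2 + j + 1 = (k + j + 2) + 1 by ring, show k + (j + 1) + 1 = k + j + 2 by ring,
      Nat.factorial_succ N, Nat.factorial_succ j, Nat.factorial_succ (k + j + 2)]
    have h1 := Nat.factorial_pos j
    have h2 := Nat.factorial_pos (k + j + 2)
    push_cast
    rw [hN]
    field_simp
    ring

/-! ### Colored Dyck words -/

section Dyck

variable {s : ℕ}

/-- The stack of open brackets after a word of brackets, `none` if the word fails. -/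
def dyckLabel {N : ℕ} (w : Fin N → Bracket s) : Option (List (Fin s)) :=
  (List.ofFn w).foldl dyckStep (some [])

theorem dyckStep_inl_eq_some (x : Option (List (Fin s))) (c : Fin s) (l : List (Fin s)) :
    dyckStep x (Sum.inl c) = some l ↔ ∃ l', l = c :: l' ∧ x = some l' := by
  cases x with
  | none => simp [dyckStep]
  | some σ => simp [dyckStep, eq_comm]

theorem dyckStep_inr_eq_some (x : Option (List (Fin s))) (c : Fin s) (l : List (Fin s)) :
    dyckStep x (Sum.inr c) = some l ↔ x = some (c :: l) := by
  rcases x with _ | _ | ⟨b, σ⟩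
  · simp [dyckStep]
  · simp [dyckStep]
  · by_cases h : c = b
    · simp [dyckStep, h]
    · simp [dyckStep, h, Ne.symm h]

/-- The number of words that open a given stack of brackets depends on its height only. -/
theorem labelCount_dyckLabel (N : ℕ) : ∀ l : List (Fin s),
    labelCount (dyckLabel (N := N)) (some l) = stackCount s s N l.length := by
  induction N with
  | zero =>
    intro l
    cases l <;> simp [labelCount, dyckLabel, stackCount]
  | succ N ih =>
    intro l
    unfold dyckLabel
    rw [labelCount_foldl_succ, Fintype.sum_sum_type]
    have h2 : ∀ c : Fin s, (Finset.univ.filter fun w : Fin N → Bracket s =>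
        dyckStep ((List.ofFn w).foldl dyckStep (some [])) (Sum.inr c) = some l).card =
        stackCount s s N (l.length + 1) := by
      intro c
      simp only [dyckStep_inr_eq_some]
      exact ih (c :: l)
    rw [Finset.sum_congr rfl fun c _ => h2 c]
    cases l with
    | nil => simp [dyckStep_inl_eq_some, stackCount]
    | cons b l =>
      rw [Finset.sum_eq_single b]
      · have := ih l
        simp only [dyckStep_inl_eq_some, List.cons.injEq, true_and, exists_eq_left',
          List.length_cons, stackCount]
        simp only [labelCount, dyckLabel] at this
        simp only [Finset.sum_const, Finset.card_univ, Fintype.card_fin, smul_eq_mul]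
        congr 1
      · intro c _ hc
        simp [dyckStep_inl_eq_some, hc.symm]
      · simp

theorem foldl_dyckStep_none (v : List (Bracket s)) : v.foldl dyckStep none = none := by
  induction v with
  | nil => rfl
  | cons a v ih => exact ih

/-- A word closes the open brackets of a stack exactly when its mirror image opens them. -/
theorem foldl_dyckStep_eq_nil_iff (v : List (Bracket s)) : ∀ σ : List (Fin s),
    v.foldl dyckStep (some σ) = some [] ↔
      (v.reverse.map Sum.swap).foldl dyckStep (some []) = some σ := by
  induction v with
  | nil => intro σ; simp [eq_comm]
  | cons a v ih =>
    intro σ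
    rw [List.reverse_cons, List.map_append, List.foldl_append, List.foldl_cons]
    rcases a with c | c
    · simp only [List.map_cons, List.map_nil, List.foldl_cons, List.foldl_nil, Sum.swap_inl,
        dyckStep_inr_eq_some]
      exact ih (c :: σ)
    · simp only [List.map_cons, List.map_nil, List.foldl_cons, List.foldl_nil, Sum.swap_inr,
        dyckStep_inl_eq_some]
      rcases σ with _ | ⟨b, σ⟩
      · simp [dyckStep, foldl_dyckStep_none]
      · by_cases h : c = b
        · simp [dyckStep, h, ih]
        · have h' : ¬b = c := fun e => h e.symm
          simp only [dyckStep, h, if_false, foldl_dyckStep_none, List.cons.injEq, h',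
            false_and, exists_false, reduceCtorEq]

/-- The mirror image of a word of brackets: the order is reversed, and left and right brackets are
exchanged. -/
def mirror (N : ℕ) : (Fin N → Bracket s) ≃ (Fin N → Bracket s) :=
  Equiv.arrowCongr Fin.revPerm (Equiv.sumComm _ _)

theorem ofFn_comp_rev {α : Type} {N : ℕ} (w : Fin N → α) :
    List.ofFn (fun i => w i.rev) = (List.ofFn w).reverse := by
  apply List.ext_getElem
  · simp
  · intro i h1 h2
    simp only [List.getElem_ofFn, List.getElem_reverse, List.length_ofFn]
    congr 1
    ext
    simp [Fin.rev]
    omega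

theorem ofFn_mirror {N : ℕ} (w : Fin N → Bracket s) :
    List.ofFn (mirror N w) = (List.ofFn w).reverse.map Sum.swap := by
  rw [← ofFn_comp_rev, List.map_ofFn]
  rfl

/-- The stacks of height `k` of open brackets of `s` colors. -/
def dyckStacks (s k : ℕ) : Finset (Option (List (Fin s))) :=
  Finset.univ.image fun w : Fin k → Fin s => some (List.ofFn w)

theorem mem_dyckStacks {k : ℕ} {x : Option (List (Fin s))} :
    x ∈ dyckStacks s k ↔ ∃ l, x = some l ∧ l.length = k := by
  simp only [dyckStacks, Finset.mem_image, Finset.mem_univ, true_and]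
  constructor
  · rintro ⟨w, rfl⟩
    exact ⟨_, rfl, by simp⟩
  · rintro ⟨l, rfl, rfl⟩
    exact ⟨l.get, by rw [List.ofFn_get]⟩

theorem card_dyckStacks (k : ℕ) : (dyckStacks s k).card = s ^ k := by
  rw [dyckStacks, Finset.card_image_of_injective]
  · simp
  · intro w w' h
    exact List.ofFn_injective (Option.some_injective _ h)

/-- A word of length `2 n + 2 n` is well-bracketed exactly when its first half and the mirror
image of its second half succeed with the same stack, whose height is then even and at most `2 n`.
-/
theorem append_mem_dyckWords_iff (n : ℕ) (u v : Fin (2 * n) → Bracket s) :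
    Fin.append u v ∈ dyckWords s (2 * n + 2 * n) ↔
      dyckLabel u = dyckLabel (mirror (2 * n) v) ∧
        dyckLabel u ∈ (Finset.range (n + 1)).biUnion fun i => dyckStacks s (2 * i) := by
  have hu : ∀ l, dyckLabel u = some l → ∃ i, i < n + 1 ∧ l.length = 2 * i := by
    intro l hl
    have h1 : labelCount (dyckLabel (N := 2 * n)) (some l) ≠ 0 :=
      (Finset.card_pos.2 ⟨u, by simpa using hl⟩).ne'
    rw [labelCount_dyckLabel] at h1
    obtain ⟨j, hj⟩ := exists_of_stackCount_ne_zero h1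
    exact ⟨n - j, by omega, by omega⟩
  have hv : ∀ l, dyckLabel (mirror (2 * n) v) = some l ↔
      (List.ofFn v).foldl dyckStep (some l) = some [] := by
    intro l
    rw [foldl_dyckStep_eq_nil_iff, dyckLabel, ofFn_mirror]
  rw [dyckWords, Set.mem_ofPred_eq, List.ofFn_fin_append, List.foldl_append]
  change (List.ofFn v).foldl dyckStep (dyckLabel u) = some [] ↔ _
  simp only [Finset.mem_biUnion, Finset.mem_range, mem_dyckStacks]
  constructor
  · intro h
    cases hl : dyckLabel u with
    | none =>
      rw [hl] at h
      rw [foldl_dyckStep_none] at h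
      cases h
    | some l =>
      rw [hl] at h
      obtain ⟨i, hi, hli⟩ := hu l hl
      exact ⟨((hv l).2 h).symm, i, hi, l, rfl, hli⟩
  · rintro ⟨h1, i, hi, l, hl, -⟩
    rw [hl]
    exact (hv l).1 (h1.symm.trans hl)

end Dyck

/-! ### Fully reducible words -/

section FullyReducible

variable {d : ℕ}

/-- A stack is reduced if no two neighboring letters are equal. -/
def Reduced (l : List (Fin d)) : Prop := l.IsChain (· ≠ ·)

theorem Reduced.tail {b : Fin d} {l : List (Fin d)} (h : Reduced (b :: l)) : Reduced l :=
  List.IsChain.tail h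

theorem reduced_cons_cons {a b : Fin d} {l : List (Fin d)} :
    Reduced (a :: b :: l) ↔ a ≠ b ∧ Reduced (b :: l) :=
  List.isChain_cons_cons

theorem Reduced.pfStep {l : List (Fin d)} (h : Reduced l) (a : Fin d) : Reduced (pfStep l a) := by
  rcases l with _ | ⟨b, l⟩
  · exact List.isChain_singleton a
  · rw [PairFlip.pfStep]
    split_ifs with hab
    · exact h.tail
    · exact reduced_cons_cons.2 ⟨hab, h⟩

theorem Reduced.foldl_pfStep (w : List (Fin d)) : ∀ {l : List (Fin d)}, Reduced l →
    Reduced (w.foldl PairFlip.pfStep l) := by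
  induction w with
  | nil => exact fun h => h
  | cons a w ih => exact fun h => ih (h.pfStep a)

theorem Reduced.pfStep_pfStep {l : List (Fin d)} (h : Reduced l) (a : Fin d) :
    PairFlip.pfStep (PairFlip.pfStep l a) a = l := by
  rcases l with _ | ⟨b, _ | ⟨c, l⟩⟩
  · simp [PairFlip.pfStep]
  · by_cases hab : a = b <;> simp [PairFlip.pfStep, hab]
  · by_cases hab : a = b
    · subst hab
      simp [PairFlip.pfStep, (reduced_cons_cons.1 h).1]
    · simp [PairFlip.pfStep, hab]

theorem Reduced.pfStep_eq_iff {l m : List (Fin d)} (hl : Reduced l) (hm : Reduced m) (a : Fin d) :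
    PairFlip.pfStep l a = m ↔ l = PairFlip.pfStep m a := by
  constructor
  · rintro rfl
    exact (hl.pfStep_pfStep a).symm
  · rintro rfl
    exact hm.pfStep_pfStep a

theorem reduced_nil : Reduced ([] : List (Fin d)) := List.isChain_nil

/-- A word cancels a reduced stack exactly when the reversed word builds it. -/
theorem foldl_pfStep_eq_nil_iff (v : List (Fin d)) : ∀ {σ : List (Fin d)}, Reduced σ →
    (v.foldl pfStep σ = [] ↔ σ = v.reverse.foldl pfStep []) := by
  induction v with
  | nil => intro σ _; rfl
  | cons a v ih =>
    intro σ hσ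
    rw [List.foldl_cons, ih (hσ.pfStep a), List.reverse_cons, List.foldl_append,
      hσ.pfStep_eq_iff (reduced_nil.foldl_pfStep _)]
    rfl

/-- The stack left by a word. -/
def pfLabel {N : ℕ} (w : Fin N → Fin d) : List (Fin d) := (List.ofFn w).foldl pfStep []

theorem reduced_pfLabel {N : ℕ} (w : Fin N → Fin d) : Reduced (pfLabel w) :=
  reduced_nil.foldl_pfStep _

/-- The number of words that leave a given reduced stack depends on its height only. Each letter
acts on the reduced stacks as an involution, so the predecessors of a stack are its successors. -/
theorem labelCount_pfLabel (N : ℕ) : ∀ l : List (Fin d), Reduced l →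
    labelCount (pfLabel (N := N)) l = stackCount d (d - 1) N l.length := by
  induction N with
  | zero =>
    intro l
    cases l <;> simp [labelCount, pfLabel, stackCount]
  | succ N ih =>
    intro l hl
    have h1 : labelCount (pfLabel (N := N + 1)) l =
        ∑ a, labelCount (pfLabel (N := N)) (pfStep l a) := by
      unfold pfLabel
      rw [labelCount_foldl_succ]
      refine Finset.sum_congr rfl fun a _ => ?_
      unfold labelCount
      congr 1
      refine Finset.filter_congr fun w _ => ?_
      exact (reduced_pfLabel w).pfStep_eq_iff hl a
    rw [h1, Finset.sum_congr rfl fun a _ => ih _ (hl.pfStep a)]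
    cases l with
    | nil => simp [pfStep, stackCount]
    | cons b l =>
      rw [← Finset.add_sum_erase _ _ (Finset.mem_univ b),
        Finset.sum_congr rfl (g := fun _ => stackCount d (d - 1) N (l.length + 2))]
      · simp [pfStep, stackCount]
      · intro a ha
        rw [pfStep, if_neg (Finset.ne_of_mem_erase ha)]
        rfl

/-- The reduced stacks of height `k`. -/
def reducedStacks (d : ℕ) : ℕ → Finset (List (Fin d))
  | 0 => {[]}
  | k + 1 => (reducedStacks d k).biUnion fun l =>
      (Finset.univ.filter fun a => l.head? ≠ some a).image fun a => a :: l

theorem mem_reducedStacks : ∀ {k : ℕ} {l : List (Fin d)},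
    l ∈ reducedStacks d k ↔ Reduced l ∧ l.length = k
  | 0, l => by
    simp only [reducedStacks, Finset.mem_singleton, List.length_eq_zero_iff]
    constructor
    · rintro rfl
      exact ⟨reduced_nil, rfl⟩
    · exact fun h => h.2
  | k + 1, l => by
    simp only [reducedStacks, Finset.mem_biUnion, Finset.mem_image, Finset.mem_filter,
      Finset.mem_univ, true_and]
    constructor
    · rintro ⟨l', hl', a, ha, rfl⟩
      obtain ⟨h1, h2⟩ := mem_reducedStacks.1 hl'
      refine ⟨List.isChain_cons.2 ⟨fun y hy e => ha ?_, h1⟩, by simp [h2]⟩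
      rw [e]
      exact hy
    · rintro ⟨h1, h2⟩
      rcases l with _ | ⟨a, l⟩
      · simp at h2
      · obtain ⟨h3, h4⟩ := List.isChain_cons.1 h1
        exact ⟨l, mem_reducedStacks.2 ⟨h4, by simpa using h2⟩, a, fun e => h3 a e rfl, rfl⟩

theorem card_reducedStacks_succ (k : ℕ) :
    (reducedStacks d (k + 1)).card = d * (d - 1) ^ k := by
  have hstep : ∀ k, (reducedStacks d (k + 1)).card = ∑ l ∈ reducedStacks d k,
      (Finset.univ.filter fun a : Fin d => l.head? ≠ some a).card := by
    intro k
    rw [reducedStacks, Finset.card_biUnion]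
    · refine Finset.sum_congr rfl fun l _ => Finset.card_image_of_injective _ ?_
      intro a a' h
      exact (List.cons.inj h).1
    · intro l _ l' _ hll
      rw [Function.onFun, Finset.disjoint_left]
      simp only [Finset.mem_image, not_exists, not_and]
      rintro _ ⟨a, _, rfl⟩ a' _ h
      exact hll (List.cons.inj h).2.symm
  induction k with
  | zero =>
    rw [hstep]
    simp [reducedStacks]
  | succ k ih =>
    rw [hstep, Finset.sum_congr rfl (g := fun _ => d - 1), Finset.sum_const, ih, smul_eq_mul,
      pow_succ, mul_assoc]
    intro l hl
    obtain ⟨-, h2⟩ := mem_reducedStacks.1 hl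
    rcases l with _ | ⟨b, l⟩
    · simp at h2
    · simp only [List.head?_cons, ne_eq, Option.some.injEq]
      rw [Finset.filter_ne]
      simp

/-- The reversal of words. -/
def wordReverse (N : ℕ) : (Fin N → Fin d) ≃ (Fin N → Fin d) :=
  Equiv.arrowCongr Fin.revPerm (Equiv.refl _)

/-- A word of length `2 n + 2 n` is fully reducible exactly when its first half and its reversed
second half leave the same stack. The condition on the height always holds. -/
theorem append_mem_fullyReducibleWords_iff (n : ℕ) (u v : Fin (2 * n) → Fin d) :
    Fin.append u v ∈ fullyReducibleWords d (2 * n + 2 * n) ↔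
      pfLabel u = pfLabel (wordReverse (2 * n) v) ∧
        pfLabel u ∈ (Finset.range (n + 1)).biUnion fun i => reducedStacks d (2 * i) := by
  have hu : pfLabel u ∈ (Finset.range (n + 1)).biUnion fun i => reducedStacks d (2 * i) := by
    have h1 : labelCount (pfLabel (N := 2 * n)) (pfLabel u) ≠ 0 :=
      (Finset.card_pos.2 ⟨u, by simp⟩).ne'
    rw [labelCount_pfLabel _ _ (reduced_pfLabel u)] at h1
    obtain ⟨j, hj⟩ := exists_of_stackCount_ne_zero h1
    simp only [Finset.mem_biUnion, Finset.mem_range, mem_reducedStacks]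
    exact ⟨n - j, by omega, reduced_pfLabel u, by omega⟩
  have hv : pfLabel (wordReverse (2 * n) v) = (List.ofFn v).reverse.foldl pfStep [] := by
    rw [← ofFn_comp_rev]
    rfl
  rw [fullyReducibleWords, Set.mem_ofPred_eq, irreducibleString, List.reverse_eq_nil_iff,
    List.ofFn_fin_append, List.foldl_append]
  change (List.ofFn v).foldl pfStep (pfLabel u) = [] ↔ _
  rw [foldl_pfStep_eq_nil_iff _ (reduced_pfLabel u), hv]
  exact (and_iff_left hu).symm

end FullyReducible

/-! ### Entropy of a spectrum that depends on the height only -/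

/-- The entropy in bits of the distribution that gives each of `W i` points, `i ≤ n`, a
probability proportional to `V i`. -/
noncomputable def levelEntropy (n : ℕ) (W V : ℕ → ℝ) : ℝ :=
  -∑ i ∈ Finset.range (n + 1), W i * (V i / (∑ j ∈ Finset.range (n + 1), W j * V j) *
    Real.logb 2 (V i / (∑ j ∈ Finset.range (n + 1), W j * V j)))

/-- The mean of the height `2 i` with respect to weights proportional to `U i`, `i ≤ n`. -/
noncomputable def meanHeight (n : ℕ) (U : ℕ → ℝ) : ℝ :=
  (∑ i ∈ Finset.range (n + 1), (2 * i : ℝ) * U i) / ∑ i ∈ Finset.range (n + 1), U i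

theorem meanHeight_const_mul (n : ℕ) (U : ℕ → ℝ) {κ : ℝ} (hκ : κ ≠ 0) :
    meanHeight n (fun i => κ * U i) = meanHeight n U := by
  unfold meanHeight
  rw [← Finset.mul_sum, ← mul_div_mul_left _ (∑ i ∈ Finset.range (n + 1), U i) hκ]
  congr 1
  rw [Finset.mul_sum]
  exact Finset.sum_congr rfl fun i _ => by ring

theorem entanglementEntropy_eq_levelEntropy {α X : Type} [Fintype α] [DecidableEq α]
    [DecidableEq X] {a b : ℕ} (T : Set (Fin (a + b) → α)) (τ : (Fin a → α) → X)
    (τ' : (Fin b → α) → X) (L : ℕ → Finset X) (n : ℕ) (A : ℕ → ℕ)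
    (hT : ∀ u v, Fin.append u v ∈ T ↔
      τ u = τ' v ∧ τ u ∈ (Finset.range (n + 1)).biUnion L)
    (hL : Pairwise fun i j => Disjoint (L i) (L j))
    (hA : ∀ i, ∀ σ ∈ L i, labelCount τ σ = A i) (hA' : ∀ i, ∀ σ ∈ L i, labelCount τ' σ = A i) :
    entanglementEntropy a b (uniformSuperposition T) =
      levelEntropy n (fun i => (L i).card) fun i => (A i : ℝ) ^ 2 := by
  have hd : Set.PairwiseDisjoint (Finset.range (n + 1) : Set ℕ) L := fun i _ j _ hij => hL hij
  have hZ : (T.ncard : ℝ) = ∑ j ∈ Finset.range (n + 1), ((L j).card : ℝ) * (A j : ℝ) ^ 2 := by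
    rw [ncard_eq_sum_labelCount T _ τ τ' hT, Finset.sum_biUnion hd]
    push_cast
    refine Finset.sum_congr rfl fun i _ => ?_
    rw [Finset.sum_congr rfl (g := fun _ => (A i : ℝ) ^ 2)]
    · simp
    · intro σ hσ
      rw [hA i σ hσ, hA' i σ hσ, pow_two]
  rw [entanglementEntropy_uniformSuperposition T _ τ τ' hT, levelEntropy, ← hZ,
    Finset.sum_biUnion hd]
  refine congrArg _ (Finset.sum_congr rfl fun i _ => ?_)
  rw [Finset.sum_congr rfl
    (g := fun _ => (A i : ℝ) ^ 2 / T.ncard * Real.logb 2 ((A i : ℝ) ^ 2 / T.ncard))]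
  · simp
  · intro σ hσ
    rw [hA i σ hσ, hA' i σ hσ, pow_two]

/-- Grouping by height, the entropy is the entropy of the height, which lies between `0` and
`log₂ (n + 1)`, plus the mean logarithm of the number of points of that height. -/
theorem levelEntropy_bounds {n : ℕ} {W V : ℕ → ℝ} {s κ : ℝ} (hs : 0 < s)
    (hκ : 0 < κ) (hV : ∀ i, 0 ≤ V i) (hlo : ∀ i, s ^ (2 * i) ≤ W i)
    (hhi : ∀ i, W i ≤ κ * s ^ (2 * i))
    (hZ : 0 < ∑ j ∈ Finset.range (n + 1), W j * V j) :
    Real.logb 2 s * meanHeight n (fun i => W i * V i) ≤ levelEntropy n W V ∧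
      levelEntropy n W V ≤ Real.logb 2 (n + 1) + Real.logb 2 κ +
        Real.logb 2 s * meanHeight n (fun i => W i * V i) := by
  have h2 : (0 : ℝ) < Real.log 2 := Real.log_pos one_lt_two
  have hW : ∀ i, 0 < W i := fun i => (pow_pos hs _).trans_le (hlo i)
  rw [levelEntropy, meanHeight]
  set Z := ∑ j ∈ Finset.range (n + 1), W j * V j with hZdef
  set P : ℕ → ℝ := fun i => W i * V i / Z with hP
  have hP0 : ∀ i, 0 ≤ P i := fun i => div_nonneg (mul_nonneg (hW i).le (hV i)) hZ.le
  have hPsum : ∑ i ∈ Finset.range (n + 1), P i = 1 := by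
    rw [hP, ← Finset.sum_div, div_self hZ.ne']
  have hP1 : ∀ i ∈ Finset.range (n + 1), P i ≤ 1 := fun i hi =>
    hPsum ▸ Finset.single_le_sum (fun i _ => hP0 i) hi
  have hmean : (∑ i ∈ Finset.range (n + 1), (2 * i : ℝ) * (W i * V i)) / Z =
      ∑ i ∈ Finset.range (n + 1), (2 * i : ℝ) * P i := by
    rw [Finset.sum_div]
    exact Finset.sum_congr rfl fun i _ => mul_div_assoc _ _ _
  have hterm : ∀ i, -(W i * (V i / Z * Real.logb 2 (V i / Z))) =
      P i * Real.logb 2 (W i) - P i * Real.logb 2 (P i) := by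
    intro i
    rcases (hV i).eq_or_lt with h | h
    · simp [hP, ← h]
    · have h3 : V i / Z = P i / W i := by
        rw [hP]
        field_simp [(hW i).ne']
      have h4 : 0 < P i := div_pos (mul_pos (hW i) h) hZ
      rw [h3, Real.logb_div h4.ne' (hW i).ne']
      field_simp [(hW i).ne']
      ring
  rw [hmean, ← Finset.sum_neg_distrib, Finset.sum_congr rfl fun i _ => hterm i, Finset.mul_sum]
  have hlogW : ∀ i : ℕ, (2 * i : ℝ) * Real.logb 2 s ≤ Real.logb 2 (W i) := by
    intro i
    have := Real.logb_le_logb_of_le (b := 2) one_lt_two (pow_pos hs _) (hlo i)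
    rw [Real.logb_pow] at this
    exact_mod_cast this
  have hlogW' : ∀ i : ℕ, Real.logb 2 (W i) ≤ Real.logb 2 κ + (2 * i : ℝ) * Real.logb 2 s := by
    intro i
    have := Real.logb_le_logb_of_le (b := 2) one_lt_two (hW i) (hhi i)
    rw [Real.logb_mul hκ.ne' (pow_pos hs _).ne', Real.logb_pow] at this
    exact_mod_cast this
  constructor
  · refine Finset.sum_le_sum fun i hi => ?_
    have h3 : P i * Real.logb 2 (P i) ≤ 0 :=
      mul_nonpos_of_nonneg_of_nonpos (hP0 i)
        (div_nonpos_of_nonpos_of_nonneg (Real.log_nonpos (hP0 i) (hP1 i hi)) h2.le)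
    have h4 := mul_le_mul_of_nonneg_left (hlogW i) (hP0 i)
    linarith
  · have hn : (0 : ℝ) < n + 1 := by positivity
    -- Gibbs' inequality against the uniform distribution on the `n + 1` heights.
    have hG : ∀ i, -(P i * Real.logb 2 (P i)) ≤
        P i * Real.logb 2 (n + 1) + (1 / ((n : ℝ) + 1) - P i) / Real.log 2 := by
      intro i
      rcases (hP0 i).eq_or_lt with h | h
      · rw [← h]
        simp only [zero_mul, neg_zero, sub_zero, zero_add]
        positivity
      · have h3 := Real.log_le_sub_one_of_pos (x := 1 / (P i * (n + 1))) (by positivity)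
        rw [one_div, Real.log_inv, Real.log_mul h.ne' hn.ne'] at h3
        have h4 := mul_le_mul_of_nonneg_left h3 h.le
        have h5 : P i * ((P i * ((n : ℝ) + 1))⁻¹ - 1) = 1 / ((n : ℝ) + 1) - P i := by
          field_simp
        rw [h5] at h4
        rw [Real.logb, Real.logb, ← sub_nonneg]
        have h6 : P i * (Real.log (n + 1) / Real.log 2) +
            (1 / ((n : ℝ) + 1) - P i) / Real.log 2 - -(P i * (Real.log (P i) / Real.log 2)) =
            ((1 / ((n : ℝ) + 1) - P i) - P i * (-(Real.log (P i) + Real.log (n + 1)))) /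
              Real.log 2 := by
          ring
        rw [h6]
        exact div_nonneg (by linarith) h2.le
    have hsum : ∑ i ∈ Finset.range (n + 1), (P i * Real.logb 2 (n + 1) +
        (1 / ((n : ℝ) + 1) - P i) / Real.log 2 +
        (P i * Real.logb 2 κ + Real.logb 2 s * (2 * i * P i))) =
        Real.logb 2 (n + 1) + Real.logb 2 κ +
          ∑ i ∈ Finset.range (n + 1), Real.logb 2 s * (2 * i * P i) := by
      have h3 : ∑ i ∈ Finset.range (n + 1), (1 / ((n : ℝ) + 1) - P i) = 0 := by
        rw [Finset.sum_sub_distrib, hPsum, Finset.sum_const, Finset.card_range, nsmul_eq_mul]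
        push_cast
        rw [mul_one_div_cancel hn.ne', sub_self]
      rw [Finset.sum_add_distrib, Finset.sum_add_distrib, Finset.sum_add_distrib, ← Finset.sum_div,
        h3, ← Finset.sum_mul _ P, ← Finset.sum_mul _ P, hPsum]
      ring
    rw [← hsum]
    refine Finset.sum_le_sum fun i _ => ?_
    have h3 := mul_le_mul_of_nonneg_left (hlogW' i) (hP0 i)
    have h4 := hG i
    linarith

/-! ### Moments of the ballot numbers -/

/-- The ballot numbers `#{nonnegative walks of length 2 n from 0 to 2 i} / (2 i + 1)`, normalized
to `1` at `i = 0`. They vanish for `i > n`. -/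
noncomputable def ballotWeight (n : ℕ) : ℕ → ℝ
  | 0 => 1
  | i + 1 => ballotWeight n i * ((n - i) / (n + i + 2))

theorem ballotWeight_of_lt {n i : ℕ} (h : n < i) : ballotWeight n i = 0 := by
  induction i with
  | zero => omega
  | succ i ih =>
    rw [ballotWeight]
    rcases (Nat.lt_succ_iff.1 h).eq_or_lt with h | h
    · simp [h]
    · rw [ih h, zero_mul]

theorem ballotWeight_nonneg (n i : ℕ) : 0 ≤ ballotWeight n i := by
  induction i with
  | zero => exact zero_le_one
  | succ i ih =>
    rcases lt_or_ge n (i + 1) with h | h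
    · rw [ballotWeight_of_lt h]
    · rw [ballotWeight]
      have : (i : ℝ) + 1 ≤ n := by exact_mod_cast h
      exact mul_nonneg ih (div_nonneg (by linarith) (by positivity))

theorem ballotWeight_succ_mul (n i : ℕ) :
    (n + i + 2) * ballotWeight n (i + 1) = (n - i) * ballotWeight n i := by
  have : (n : ℝ) + i + 2 ≠ 0 := by positivity
  rw [ballotWeight]
  field_simp

theorem ballotWeight_succ_le (n i : ℕ) : ballotWeight n (i + 1) ≤ ballotWeight n i := by
  rw [ballotWeight]
  refine mul_le_of_le_one_right (ballotWeight_nonneg n i) ?_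
  rw [div_le_one (by positivity)]
  have : (0 : ℝ) ≤ i := Nat.cast_nonneg i
  linarith

/-- The moments of the squared ballot weights with respect to `2 i + 1`. -/
noncomputable def ballotMoment (n j : ℕ) : ℝ :=
  ∑ i ∈ Finset.range (n + 1), (2 * i + 1 : ℝ) ^ j * ballotWeight n i ^ 2

theorem ballotMoment_pos (n j : ℕ) : 0 < ballotMoment n j :=
  Finset.sum_pos' (fun i _ => by positivity) ⟨0, by simp, by simp [ballotWeight]⟩

/-- Summation by parts: `(n + i + 1)² bᵢ² - (n + i + 2)² bᵢ₊₁² = (2 n + 1) (2 i + 1) bᵢ²`. -/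
theorem sum_mul_ballotWeight_sq (n : ℕ) (f : ℕ → ℝ) :
    (2 * n + 1) * ∑ i ∈ Finset.range (n + 1), f i * ((2 * i + 1) * ballotWeight n i ^ 2) =
      f 0 * (n + 1) ^ 2 + ∑ i ∈ Finset.range n,
        (f (i + 1) - f i) * ((n + (i + 1 : ℕ) + 1) ^ 2 * ballotWeight n (i + 1) ^ 2) := by
  have key : ∀ m, (2 * n + 1) * ∑ i ∈ Finset.range m,
      f i * ((2 * i + 1) * ballotWeight n i ^ 2) =
      f 0 * (n + 1) ^ 2 - f m * ((n + m + 1) ^ 2 * ballotWeight n m ^ 2) +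
      ∑ i ∈ Finset.range m,
        (f (i + 1) - f i) * ((n + (i + 1 : ℕ) + 1) ^ 2 * ballotWeight n (i + 1) ^ 2) := by
    intro m
    induction m with
    | zero => simp [ballotWeight]
    | succ m ih =>
      rw [Finset.sum_range_succ, mul_add, ih, Finset.sum_range_succ]
      have h : ((n : ℝ) + (m + 1 : ℕ) + 1) ^ 2 * ballotWeight n (m + 1) ^ 2 =
          (n - m) ^ 2 * ballotWeight n m ^ 2 := by
        rw [← mul_pow, ← mul_pow, ← ballotWeight_succ_mul]
        push_cast
        ring
      rw [h]
      ring
  rw [key, Finset.sum_range_succ, ballotWeight_of_lt (Nat.lt_succ_self n)]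
  ring

theorem le_ballotMoment_three (n : ℕ) : n / 2 * ballotMoment n 1 ≤ ballotMoment n 3 := by
  have h := sum_mul_ballotWeight_sq n fun i => (2 * i + 1 : ℝ) ^ 2
  have h3 : ∑ i ∈ Finset.range (n + 1), (2 * i + 1 : ℝ) ^ 2 * ((2 * i + 1) *
      ballotWeight n i ^ 2) = ballotMoment n 3 :=
    Finset.sum_congr rfl fun i _ => by ring
  have h1 : ((n : ℝ) + 1) ^ 2 * ballotMoment n 1 ≤ (2 * n + 1) * ballotMoment n 3 := by
    rw [← h3, h, ballotMoment, Finset.sum_range_succ', mul_add, Finset.mul_sum, add_comm]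
    refine add_le_add (by simp [ballotWeight]) (Finset.sum_le_sum fun i _ => ?_)
    have hb := sq_nonneg (ballotWeight n (i + 1))
    have hi : (0 : ℝ) ≤ i := Nat.cast_nonneg i
    have hn : (0 : ℝ) ≤ n := Nat.cast_nonneg n
    have e1 : ((n : ℝ) + 1) ^ 2 ≤ (n + (i + 1 : ℕ) + 1) ^ 2 := by
      push_cast
      gcongr
      linarith
    have e2 : (2 * (i + 1 : ℕ) + 1 : ℝ) ^ 1 ≤ (2 * (i + 1 : ℕ) + 1 : ℝ) ^ 2 - (2 * i + 1) ^ 2 := by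
      push_cast
      nlinarith
    calc ((n : ℝ) + 1) ^ 2 * ((2 * (i + 1 : ℕ) + 1 : ℝ) ^ 1 * ballotWeight n (i + 1) ^ 2)
        = (2 * (i + 1 : ℕ) + 1 : ℝ) ^ 1 * (((n : ℝ) + 1) ^ 2 * ballotWeight n (i + 1) ^ 2) := by
          ring
      _ ≤ _ := mul_le_mul e2 (mul_le_mul_of_nonneg_right e1 hb) (by positivity)
          (le_trans (by positivity) e2)
  have h2 := (ballotMoment_pos n 1).le
  have hn : (0 : ℝ) ≤ n := Nat.cast_nonneg n
  have h4 : (0 : ℝ) < 2 * n + 1 := by positivity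
  refine le_of_mul_le_mul_left (le_trans ?_ h1) h4
  rw [← mul_assoc]
  gcongr
  nlinarith

theorem ballotMoment_four_le (n : ℕ) :
    ballotMoment n 4 ≤ 6 * (2 * n + 1) * ballotMoment n 2 := by
  have h := sum_mul_ballotWeight_sq n fun i => (2 * i + 1 : ℝ) ^ 3
  have h3 : ∑ i ∈ Finset.range (n + 1), (2 * i + 1 : ℝ) ^ 3 * ((2 * i + 1) *
      ballotWeight n i ^ 2) = ballotMoment n 4 :=
    Finset.sum_congr rfl fun i _ => by ring
  have hn : (0 : ℝ) ≤ n := Nat.cast_nonneg n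
  have h1 : (2 * n + 1) * ballotMoment n 4 ≤ 6 * (2 * n + 1) ^ 2 * ballotMoment n 2 := by
    rw [← h3, h, ballotMoment, Finset.sum_range_succ', mul_add, Finset.mul_sum, add_comm]
    refine add_le_add (Finset.sum_le_sum fun i hi => ?_) ?_
    · have hb := sq_nonneg (ballotWeight n (i + 1))
      have hi0 : (0 : ℝ) ≤ i := Nat.cast_nonneg i
      have hin : (i : ℝ) + 1 ≤ n := by exact_mod_cast Finset.mem_range.1 hi
      have e1 : ((n : ℝ) + (i + 1 : ℕ) + 1) ^ 2 ≤ (2 * n + 1) ^ 2 := by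
        push_cast
        gcongr
        linarith
      have e2 : (2 * (i + 1 : ℕ) + 1 : ℝ) ^ 3 - (2 * i + 1) ^ 3 ≤
          6 * (2 * (i + 1 : ℕ) + 1 : ℝ) ^ 2 := by
        push_cast
        nlinarith
      calc ((2 * (i + 1 : ℕ) + 1 : ℝ) ^ 3 - (2 * i + 1) ^ 3) *
            ((n + (i + 1 : ℕ) + 1) ^ 2 * ballotWeight n (i + 1) ^ 2)
          ≤ 6 * (2 * (i + 1 : ℕ) + 1 : ℝ) ^ 2 *
            ((2 * n + 1) ^ 2 * ballotWeight n (i + 1) ^ 2) := by gcongr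
        _ = _ := by ring
    · simp only [ballotWeight]
      push_cast
      nlinarith
  refine le_of_mul_le_mul_left (h1.trans_eq ?_) (by positivity : (0 : ℝ) < 2 * n + 1)
  ring

theorem ballotMoment_sq_le (n j : ℕ) :
    ballotMoment n (j + 1) ^ 2 ≤ ballotMoment n j * ballotMoment n (j + 2) :=
  Finset.sum_sq_le_sum_mul_sum_of_sq_le_mul _ (fun i _ => by positivity)
    (fun i _ => by positivity) fun i _ => le_of_eq (by ring)

/-- The mean of `2 i + 1` under the squared ballot numbers is of order `√n`. -/
theorem ballotMoment_ratio_bounds {n : ℕ} (hn : 1 ≤ n) :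
    Real.sqrt n / 2 ≤ ballotMoment n 3 / ballotMoment n 2 ∧
      ballotMoment n 3 / ballotMoment n 2 ≤ 5 * Real.sqrt n ∧
      ballotMoment n 1 / ballotMoment n 2 ≤ 10 / Real.sqrt n := by
  have hn' : (1 : ℝ) ≤ n := by exact_mod_cast hn
  have p1 := ballotMoment_pos n 1
  have p2 := ballotMoment_pos n 2
  have p3 := ballotMoment_pos n 3
  have a1 := le_ballotMoment_three n
  have a2 := ballotMoment_four_le n
  have c1 := ballotMoment_sq_le n 1
  have c2 := ballotMoment_sq_le n 2
  have hsq := Real.sq_sqrt (show (0 : ℝ) ≤ n by linarith)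
  have hs : 0 < Real.sqrt n := Real.sqrt_pos.2 (by linarith)
  simp only [Nat.reduceAdd] at c1 c2
  set q := Real.sqrt n
  have hup : ballotMoment n 3 / ballotMoment n 2 ≤ 5 * q := by
    rw [div_le_iff₀ p2]
    refine le_of_sq_le_sq ?_ (by positivity)
    calc ballotMoment n 3 ^ 2 ≤ ballotMoment n 2 * ballotMoment n 4 := c2
      _ ≤ ballotMoment n 2 * (6 * (2 * n + 1) * ballotMoment n 2) := by gcongr
      _ = 6 * (2 * n + 1) * ballotMoment n 2 ^ 2 := by ring
      _ ≤ 25 * n * ballotMoment n 2 ^ 2 :=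
        mul_le_mul_of_nonneg_right (by linarith) (sq_nonneg _)
      _ = _ := by rw [← hsq]; ring
  refine ⟨?_, hup, ?_⟩
  · rw [le_div_iff₀ p2]
    refine le_of_sq_le_sq ?_ p3.le
    calc (q / 2 * ballotMoment n 2) ^ 2 = q ^ 2 / 4 * ballotMoment n 2 ^ 2 := by ring
      _ ≤ n / 4 * (ballotMoment n 1 * ballotMoment n 3) := by rw [hsq]; gcongr
      _ = (n / 2 * ballotMoment n 1) * ballotMoment n 3 / 2 := by ring
      _ ≤ ballotMoment n 3 * ballotMoment n 3 / 2 := by gcongr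
      _ ≤ ballotMoment n 3 ^ 2 := by nlinarith [sq_nonneg (ballotMoment n 3)]
  · rw [div_le_iff₀ p2] at hup ⊢
    have h1 : q * (q / 2 * ballotMoment n 1) ≤ q * (5 * ballotMoment n 2) := by
      calc q * (q / 2 * ballotMoment n 1) = n / 2 * ballotMoment n 1 := by rw [← hsq]; ring
        _ ≤ 5 * q * ballotMoment n 2 := a1.trans hup
        _ = _ := by ring
    have h2 := le_of_mul_le_mul_left h1 hs
    rw [div_mul_eq_mul_div, le_div_iff₀ hs]
    linarith

/-! ### Comparison of the two height distributions -/

theorem stackCount_two_mul_eq_zero {r s n i : ℕ} (h : n < i) :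
    stackCount r s (2 * n) (2 * i) = 0 := by
  by_contra h1
  obtain ⟨j, hj⟩ := exists_of_stackCount_ne_zero h1
  omega

/-- The Dyck counts at the even heights in terms of the ballot numbers. -/
theorem stackCount_self_mul_pow (s n i : ℕ) :
    (stackCount s s (2 * n) (2 * i) : ℝ) * s ^ i =
      stackCount s s (2 * n) 0 * ((2 * i + 1) * ballotWeight n i) := by
  induction i with
  | zero => simp [ballotWeight]
  | succ i ih =>
    rcases lt_or_ge n (i + 1) with h | h
    · rw [stackCount_two_mul_eq_zero h, ballotWeight_of_lt h]
      simp
    · obtain ⟨j, rfl⟩ := Nat.exists_eq_add_of_le h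
      set n := i + 1 + j with hn
      have hnR : (n : ℝ) = i + 1 + j := by rw [hn]; push_cast; ring
      have e1 := stackCount_self_eq s (2 * n) (2 * i) (j + 1) (by omega)
      have e2 := stackCount_self_eq s (2 * n) (2 * (i + 1)) j (by omega)
      have e3 : (stackCount s s (2 * n) (2 * (i + 1)) : ℝ) * s * ((2 * i + 1) * (n + i + 2)) =
          stackCount s s (2 * n) (2 * i) * ((2 * i + 3) * (n - i)) := by
        rw [e1, e2, hnR, show 2 * (i + 1) + j + 1 = (2 * i + j + 2) + 1 by ring,
          show 2 * i + (j + 1) + 1 = 2 * i + j + 2 by ring, Nat.factorial_succ j,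
          Nat.factorial_succ (2 * i + j + 2)]
        have h1 := Nat.factorial_pos j
        have h2 := Nat.factorial_pos (2 * i + j + 2)
        push_cast
        field_simp
        ring
      have e4 := ballotWeight_succ_mul n i
      have e5 : ((2 * i + 1) * (n + i + 2) : ℝ) ≠ 0 := by positivity
      refine mul_right_cancel₀ e5 ?_
      push_cast
      calc (stackCount s s (2 * n) (2 * (i + 1)) : ℝ) * s ^ (i + 1) * ((2 * i + 1) * (n + i + 2))
          = (stackCount s s (2 * n) (2 * (i + 1)) : ℝ) * s *
              ((2 * i + 1) * (n + i + 2)) * s ^ i := by ring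
        _ = (stackCount s s (2 * n) (2 * i) * s ^ i) * ((2 * i + 3) * (n - i)) := by
            rw [e3]; ring
        _ = stackCount s s (2 * n) 0 * (2 * i + 1) * (2 * i + 3) *
            ((n - i) * ballotWeight n i) := by rw [ih]; ring
        _ = _ := by rw [← e4]; ring

section Comparison

variable {n : ℕ} {s : ℝ} {a : ℕ → ℝ}

theorem sum_succ_eq_sum (n : ℕ) (f : ℕ → ℝ) (h0 : f 0 = 0) (hn : f (n + 1) = 0) :
    ∑ i ∈ Finset.range (n + 1), f (i + 1) = ∑ i ∈ Finset.range (n + 1), f i := by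
  rw [Finset.sum_range_succ' f, h0, Finset.sum_range_succ, hn]

/-- A solution of `aᵢ = Bᵢ + aᵢ₊₁ / s`, with `Bᵢ = (2 i + 1) bᵢ` the ballot numbers, exceeds them
at most by the factor `s / (s - 1)`, up to a relative error of order `1 / (i + 1)`. -/
theorem pairFlip_weight_le (hs : 2 ≤ s)
    (ha : ∀ i, a i = (2 * i + 1) * ballotWeight n i + a (i + 1) / s)
    (ha0 : ∀ i, n < i → a i = 0) (i : ℕ) :
    a i ≤ s / (s - 1) * ((2 * i + 3) * ballotWeight n i) := by
  have hs1 : 0 < s - 1 := by linarith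
  have key : ∀ m i, n + 1 ≤ i + m → a i ≤ s / (s - 1) * ((2 * i + 3) * ballotWeight n i) := by
    intro m
    induction m with
    | zero =>
      intro i hi
      rw [ha0 i hi]
      have := ballotWeight_nonneg n i
      positivity
    | succ m ih =>
      intro i hi
      have h1 := ih (i + 1) (by omega)
      have hb := ballotWeight_nonneg n i
      have h2 : a (i + 1) ≤ s / (s - 1) * ((2 * i + 5) * ballotWeight n i) := by
        refine h1.trans ?_
        have := ballotWeight_succ_le n i
        push_cast
        have e : (2 * ((i : ℝ) + 1) + 3) = 2 * i + 5 := by ring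
        rw [e]
        gcongr
      rw [ha i]
      calc (2 * i + 1) * ballotWeight n i + a (i + 1) / s
          ≤ (2 * i + 1) * ballotWeight n i +
            s / (s - 1) * ((2 * i + 5) * ballotWeight n i) / s := by gcongr
        _ = ((2 * i + 1) + (2 * i + 5) / (s - 1)) * ballotWeight n i := by
            field_simp
        _ ≤ (s / (s - 1) * (2 * i + 3)) * ballotWeight n i := by
            refine mul_le_mul_of_nonneg_right ?_ hb
            rw [← sub_nonneg]
            have e : s / (s - 1) * (2 * i + 3) - ((2 * i + 1) + (2 * i + 5) / (s - 1)) =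
                2 * (s - 2) / (s - 1) := by
              field_simp
              ring
            rw [e]
            exact div_nonneg (by linarith) hs1.le
        _ = _ := by ring
  exact key (n + 1) i (by omega)

theorem pairFlip_weight_nonneg (hs : 2 ≤ s)
    (ha : ∀ i, a i = (2 * i + 1) * ballotWeight n i + a (i + 1) / s)
    (ha0 : ∀ i, n < i → a i = 0) (i : ℕ) : 0 ≤ a i := by
  have key : ∀ m i, n + 1 ≤ i + m → 0 ≤ a i := by
    intro m
    induction m with
    | zero => exact fun i hi => (ha0 i hi).ge
    | succ m ih =>
      intro i hi
      have h1 := ih (i + 1) (by omega)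
      have hb := ballotWeight_nonneg n i
      rw [ha i]
      positivity
  exact key (n + 1) i (by omega)

theorem le_pairFlip_weight (hs : 2 ≤ s)
    (ha : ∀ i, a i = (2 * i + 1) * ballotWeight n i + a (i + 1) / s)
    (ha0 : ∀ i, n < i → a i = 0) (i : ℕ) :
    (2 * i + 1) * ballotWeight n i + (2 * i + 3) * ballotWeight n (i + 1) / s ≤ a i := by
  have h2 := pairFlip_weight_nonneg hs ha ha0 (i + 2)
  have hs0 : 0 < s := by linarith
  rw [ha i]
  gcongr
  rw [ha (i + 1)]
  push_cast
  have : 0 ≤ a (i + 1 + 1) / s := div_nonneg h2 hs0.le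
  linarith

/-- The number of reduced stacks of height `2 i` with `s + 1` letters, divided by `s ^ (2 i)`. -/
noncomputable def stackFactor (s : ℝ) (i : ℕ) : ℝ := if i = 0 then 1 else (s + 1) / s

theorem one_le_stackFactor (hs : 2 ≤ s) (i : ℕ) : 1 ≤ stackFactor s i := by
  unfold stackFactor
  split_ifs
  · exact le_rfl
  · rw [one_le_div (by linarith)]
    linarith

theorem stackFactor_le (hs : 2 ≤ s) (i : ℕ) : stackFactor s i ≤ (s + 1) / s := by
  unfold stackFactor
  split_ifs
  · rw [one_le_div (by linarith)]
    linarith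
  · exact le_rfl

theorem pairFlip_weight_sq_le (hs : 2 ≤ s)
    (ha : ∀ i, a i = (2 * i + 1) * ballotWeight n i + a (i + 1) / s)
    (ha0 : ∀ i, n < i → a i = 0) (i : ℕ) :
    stackFactor s i * a i ^ 2 ≤ (s + 1) / s * (s / (s - 1)) ^ 2 *
      (((2 * i + 1 : ℝ) ^ 2 * ballotWeight n i ^ 2) +
        8 * ((2 * i + 1 : ℝ) ^ 1 * ballotWeight n i ^ 2)) := by
  have h0 := pairFlip_weight_nonneg hs ha ha0 i
  have h1 := pairFlip_weight_le hs ha ha0 i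
  have hw := stackFactor_le hs i
  have hs0 : 0 < s := by linarith
  calc stackFactor s i * a i ^ 2
      ≤ (s + 1) / s * (s / (s - 1) * ((2 * i + 3) * ballotWeight n i)) ^ 2 := by gcongr
    _ = (s + 1) / s * (s / (s - 1)) ^ 2 * ((2 * i + 3 : ℝ) ^ 2 * ballotWeight n i ^ 2) := by ring
    _ ≤ _ := by
      refine mul_le_mul_of_nonneg_left ?_ (by positivity)
      have : (2 * i + 3 : ℝ) ^ 2 ≤ (2 * i + 1) ^ 2 + 8 * (2 * i + 1) ^ 1 := by
        have : (0 : ℝ) ≤ i := Nat.cast_nonneg i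
        nlinarith
      have := mul_le_mul_of_nonneg_right this (sq_nonneg (ballotWeight n i))
      linarith

theorem meanHeight_ballot (n : ℕ) :
    meanHeight n (fun i => ((2 * i + 1) * ballotWeight n i) ^ 2) =
      ballotMoment n 3 / ballotMoment n 2 - 1 := by
  have h2 : ∑ i ∈ Finset.range (n + 1), ((2 * i + 1) * ballotWeight n i) ^ 2 =
      ballotMoment n 2 := Finset.sum_congr rfl fun i _ => by ring
  have h3 : ∑ i ∈ Finset.range (n + 1), (2 * i : ℝ) * ((2 * i + 1) * ballotWeight n i) ^ 2 =
      ballotMoment n 3 - ballotMoment n 2 := by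
    rw [ballotMoment, ballotMoment, ← Finset.sum_sub_distrib]
    exact Finset.sum_congr rfl fun i _ => by ring
  rw [meanHeight, h2, h3, sub_div, div_self (ballotMoment_pos n 2).ne']

theorem meanHeight_pairFlip_le (hs : 2 ≤ s) (hn : 1 ≤ n)
    (ha : ∀ i, a i = (2 * i + 1) * ballotWeight n i + a (i + 1) / s)
    (ha0 : ∀ i, n < i → a i = 0) :
    meanHeight n (fun i => stackFactor s i * a i ^ 2) ≤
      (s / (s - 1)) ^ 2 * (ballotMoment n 3 / ballotMoment n 2 + 8) := by
  have hs0 : 0 < s := by linarith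
  have hs1 : 0 < s - 1 := by linarith
  have hκ : 0 < (s + 1) / s := by positivity
  have p2 := ballotMoment_pos n 2
  have hnum : ∑ i ∈ Finset.range (n + 1), (2 * i : ℝ) * (stackFactor s i * a i ^ 2) ≤
      (s + 1) / s * (s / (s - 1)) ^ 2 * (ballotMoment n 3 + 8 * ballotMoment n 2) := by
    rw [ballotMoment, ballotMoment, Finset.mul_sum _ _ 8, ← Finset.sum_add_distrib, Finset.mul_sum]
    refine Finset.sum_le_sum fun i _ => ?_
    have h := pairFlip_weight_sq_le hs ha ha0 i
    have h1 : 0 ≤ stackFactor s i * a i ^ 2 :=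
      mul_nonneg (zero_le_one.trans (one_le_stackFactor hs i)) (sq_nonneg _)
    calc (2 * i : ℝ) * (stackFactor s i * a i ^ 2)
        ≤ (2 * i + 1 : ℝ) * (stackFactor s i * a i ^ 2) := by gcongr; linarith
      _ ≤ (2 * i + 1 : ℝ) * _ := mul_le_mul_of_nonneg_left h (by positivity)
      _ = _ := by ring
  have hden : (s + 1) / s * ballotMoment n 2 ≤
      ∑ i ∈ Finset.range (n + 1), stackFactor s i * a i ^ 2 := by
    rw [ballotMoment, Finset.mul_sum]
    refine Finset.sum_le_sum fun i _ => ?_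
    have h := le_pairFlip_weight hs ha ha0 i
    have hb := ballotWeight_nonneg n i
    have hb1 := ballotWeight_nonneg n (i + 1)
    rcases Nat.eq_zero_or_pos i with rfl | hi
    -- At height `0` there is no factor `(s + 1) / s`, but `a₀ ≥ B₀ + B₁ / s ≥ 1 + 1 / s`.
    · have hb1' : 1 ≤ 3 * ballotWeight n 1 := by
        have hn' : (1 : ℝ) ≤ n := by exact_mod_cast hn
        simp only [ballotWeight, one_mul, Nat.cast_zero, sub_zero, add_zero]
        rw [mul_div_assoc', one_le_div (by positivity)]
        linarith
      have h2 : (s + 1) / s ≤ a 0 := by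
        refine le_trans ?_ h
        simp only [ballotWeight, Nat.cast_zero] at hb1' ⊢
        rw [add_div, div_self hs0.ne']
        gcongr
        · norm_num
        · linarith
      have h3 : 1 ≤ (s + 1) / s := by
        rw [one_le_div hs0]
        linarith
      simp only [stackFactor, ballotWeight, if_true]
      norm_num
      nlinarith
    · have h2 : 0 ≤ (2 * i + 3) * ballotWeight n (i + 1) / s := by positivity
      rw [stackFactor, if_neg hi.ne', ← mul_pow]
      gcongr
      linarith
  rw [meanHeight]
  calc _ ≤ ((s + 1) / s * (s / (s - 1)) ^ 2 * (ballotMoment n 3 + 8 * ballotMoment n 2)) /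
        ((s + 1) / s * ballotMoment n 2) := by
        have p3 := ballotMoment_pos n 3
        gcongr
    _ = _ := by
        field_simp

/-- The term `Bᵢ₊₁ / s` in the lower bound for `aᵢ` contributes the second summand on the left,
without which the constant of the comparison would be the critical one. -/
theorem le_meanHeight_pairFlip (hs : 2 ≤ s) (hn : 1 ≤ n)
    (ha : ∀ i, a i = (2 * i + 1) * ballotWeight n i + a (i + 1) / s)
    (ha0 : ∀ i, n < i → a i = 0) :
    (ballotMoment n 3 / ballotMoment n 2 - 1) +
        (ballotMoment n 3 / ballotMoment n 2 - 3) / (3 * s) ≤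
      (s / (s - 1)) ^ 2 * (1 + 8 * (ballotMoment n 1 / ballotMoment n 2)) *
        meanHeight n (fun i => stackFactor s i * a i ^ 2) := by
  have hs0 : 0 < s := by linarith
  have hs1 : 0 < s - 1 := by linarith
  have hκ : 0 < (s + 1) / s := by positivity
  have p2 := ballotMoment_pos n 2
  set B : ℕ → ℝ := fun i => (2 * i + 1) * ballotWeight n i with hB
  have hB0 : ∀ i, 0 ≤ B i := fun i => mul_nonneg (by positivity) (ballotWeight_nonneg n i)
  have hBs : ∑ i ∈ Finset.range (n + 1), (2 * i : ℝ) * B i ^ 2 =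
      ballotMoment n 3 - ballotMoment n 2 := by
    rw [ballotMoment, ballotMoment, ← Finset.sum_sub_distrib]
    exact Finset.sum_congr rfl fun i _ => by simp only [hB]; ring
  have hB3 : ∀ i, B (i + 1) ≤ 3 * B i := by
    intro i
    have h1 := ballotWeight_succ_le n i
    have h2 := ballotWeight_nonneg n i
    have h3 : (0 : ℝ) ≤ i := Nat.cast_nonneg i
    simp only [hB]
    push_cast
    calc (2 * ((i : ℝ) + 1) + 1) * ballotWeight n (i + 1)
        ≤ (2 * ((i : ℝ) + 1) + 1) * ballotWeight n i := by gcongr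
      _ ≤ (3 * (2 * i + 1)) * ballotWeight n i := by gcongr; linarith
      _ = _ := by ring
  -- Consecutive ballot numbers grow at most by a factor `3`, so shifting one of the two factors of
  -- `Bᵢ₊₁²` down by one step loses at most a constant factor.
  have hcross : ballotMoment n 3 - 3 * ballotMoment n 2 ≤
      6 * ∑ i ∈ Finset.range (n + 1), (2 * i : ℝ) * (B i * B (i + 1)) := by
    have h1 := sum_succ_eq_sum n (fun i => (2 * i : ℝ) * B i ^ 2) (by simp)
      (by simp [hB, ballotWeight_of_lt (Nat.lt_succ_self n)])
    rw [hBs] at h1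
    have h2 : B 1 ^ 2 ≤ ballotMoment n 2 := by
      have h := Finset.single_le_sum (f := fun i : ℕ => (2 * i + 1 : ℝ) ^ 2 * ballotWeight n i ^ 2)
        (fun i _ => by positivity) (Finset.mem_range.2 (show 1 < n + 1 by omega))
      refine le_trans (le_of_eq ?_) h
      simp only [hB]
      ring
    have h3 : ∑ i ∈ Finset.range (n + 1), (2 * (i + 1 : ℕ) : ℝ) * B (i + 1) ^ 2 ≤
        ∑ i ∈ Finset.range (n + 1), (6 * ((2 * i : ℝ) * (B i * B (i + 1))) +
          if i = 0 then 2 * B 1 ^ 2 else 0) := by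
      refine Finset.sum_le_sum fun i _ => ?_
      rcases Nat.eq_zero_or_pos i with rfl | hi
      · simp
      · have hi' : (1 : ℝ) ≤ i := by exact_mod_cast hi
        rw [if_neg hi.ne', add_zero]
        push_cast
        have := hB0 (i + 1)
        calc 2 * ((i : ℝ) + 1) * B (i + 1) ^ 2 = 2 * ((i : ℝ) + 1) * (B (i + 1) * B (i + 1)) := by
              ring
          _ ≤ 2 * (i + i) * (3 * B i * B (i + 1)) := by
              have := hB3 i
              gcongr
          _ = _ := by ring
    rw [Finset.sum_add_distrib, Finset.sum_ite_eq' , if_pos (by simp), ← Finset.mul_sum] at h3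
    linarith
  have hnum : (s + 1) / s * ((ballotMoment n 3 - ballotMoment n 2) +
      (ballotMoment n 3 - 3 * ballotMoment n 2) / (3 * s)) ≤
      ∑ i ∈ Finset.range (n + 1), (2 * i : ℝ) * (stackFactor s i * a i ^ 2) := by
    have h1 : ∑ i ∈ Finset.range (n + 1), (s + 1) / s * ((2 * i : ℝ) * B i ^ 2 +
        2 / s * ((2 * i : ℝ) * (B i * B (i + 1)))) ≤
        ∑ i ∈ Finset.range (n + 1), (2 * i : ℝ) * (stackFactor s i * a i ^ 2) := by
      refine Finset.sum_le_sum fun i _ => ?_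
      rcases Nat.eq_zero_or_pos i with rfl | hi
      · simp
      · rw [stackFactor, if_neg hi.ne']
        have h := le_pairFlip_weight hs ha ha0 i
        have h2 : B i + B (i + 1) / s ≤ a i := by
          refine le_trans (le_of_eq ?_) h
          simp only [hB]
          push_cast
          ring
        have h3 : B i ^ 2 + 2 / s * (B i * B (i + 1)) ≤ a i ^ 2 := by
          have h4 : (B i + B (i + 1) / s) ^ 2 ≤ a i ^ 2 :=
            pow_le_pow_left₀ (add_nonneg (hB0 i) (div_nonneg (hB0 _) hs0.le)) h2 2
          have h5 : (B i + B (i + 1) / s) ^ 2 =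
              B i ^ 2 + 2 / s * (B i * B (i + 1)) + (B (i + 1) / s) ^ 2 := by ring
          have h6 := sq_nonneg (B (i + 1) / s)
          linarith
        calc (s + 1) / s * ((2 * i : ℝ) * B i ^ 2 + 2 / s * ((2 * i : ℝ) * (B i * B (i + 1))))
            = (s + 1) / s * (2 * i) * (B i ^ 2 + 2 / s * (B i * B (i + 1))) := by ring
          _ ≤ (s + 1) / s * (2 * i) * a i ^ 2 := by gcongr
          _ = _ := by ring
    refine le_trans ?_ h1
    rw [← Finset.mul_sum, Finset.sum_add_distrib, hBs, ← Finset.mul_sum]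
    gcongr
    rw [div_le_iff₀ (by positivity)]
    refine hcross.trans (le_of_eq ?_)
    field_simp
    ring
  have hden : ∑ i ∈ Finset.range (n + 1), stackFactor s i * a i ^ 2 ≤
      (s + 1) / s * (s / (s - 1)) ^ 2 * (ballotMoment n 2 + 8 * ballotMoment n 1) := by
    rw [ballotMoment, ballotMoment, Finset.mul_sum _ _ 8, ← Finset.sum_add_distrib, Finset.mul_sum]
    exact Finset.sum_le_sum fun i _ => pairFlip_weight_sq_le hs ha ha0 i
  have hterm : ∀ i, 0 ≤ stackFactor s i * a i ^ 2 := fun i =>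
    mul_nonneg (zero_le_one.trans (one_le_stackFactor hs i)) (sq_nonneg _)
  have hZ : 0 < ∑ i ∈ Finset.range (n + 1), stackFactor s i * a i ^ 2 := by
    refine Finset.sum_pos' (fun i _ => hterm i) ⟨0, Finset.mem_range.2 (Nat.succ_pos n), ?_⟩
    have h := le_pairFlip_weight hs ha ha0 0
    have h1 := ballotWeight_nonneg n 1
    have h2 : 0 ≤ (2 * (0 : ℕ) + 3) * ballotWeight n (0 + 1) / s := by
      simp only [zero_add]
      positivity
    have h3 : 0 < a 0 := by
      simp only [ballotWeight, Nat.cast_zero] at h h2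
      linarith
    rw [stackFactor, if_pos rfl]
    positivity
  rw [meanHeight]
  set N := ∑ i ∈ Finset.range (n + 1), (2 * i : ℝ) * (stackFactor s i * a i ^ 2)
  set Z := ∑ i ∈ Finset.range (n + 1), stackFactor s i * a i ^ 2
  have hN : 0 ≤ N := Finset.sum_nonneg fun i _ => mul_nonneg (by positivity) (hterm i)
  have hkey : (s + 1) / s * ((ballotMoment n 3 - ballotMoment n 2) +
      (ballotMoment n 3 - 3 * ballotMoment n 2) / (3 * s)) ≤
      (s + 1) / s * ((s / (s - 1)) ^ 2 * (ballotMoment n 2 + 8 * ballotMoment n 1) * (N / Z)) := by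
    calc _ ≤ Z * (N / Z) := by rwa [mul_div_cancel₀ _ hZ.ne']
      _ ≤ _ := mul_le_mul_of_nonneg_right hden (div_nonneg hN hZ.le)
      _ = _ := by ring
  have h := le_of_mul_le_mul_left hkey hκ
  refine le_of_mul_le_mul_left (le_trans (le_of_eq ?_) (h.trans (le_of_eq ?_))) p2
  · field_simp
  · field_simp

end Comparison

/-! ### Entropy and Schmidt rank of the two states -/

theorem dyckEntropy_bounds {s : ℕ} (hs : 2 ≤ s) (n : ℕ) :
    Real.logb 2 s * (ballotMoment n 3 / ballotMoment n 2 - 1) ≤ dyckEntropy s n ∧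
      dyckEntropy s n ≤ Real.logb 2 (n + 1) +
        Real.logb 2 s * (ballotMoment n 3 / ballotMoment n 2 - 1) := by
  have hs0 : (0 : ℝ) < s := by exact_mod_cast (by omega : 0 < s)
  have hC : (0 : ℝ) < stackCount s s (2 * n) 0 := by
    exact_mod_cast stackCount_pos (by omega) (by omega) (2 * n) 0 n (by omega)
  have hent : dyckEntropy s n = levelEntropy n (fun i => ((dyckStacks s (2 * i)).card : ℝ))
      fun i => (stackCount s s (2 * n) (2 * i) : ℝ) ^ 2 := by
    have hc : ∀ i, ∀ σ ∈ dyckStacks s (2 * i),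
        labelCount (dyckLabel (N := 2 * n)) σ = stackCount s s (2 * n) (2 * i) := by
      intro i σ hσ
      obtain ⟨l, rfl, hl⟩ := mem_dyckStacks.1 hσ
      rw [labelCount_dyckLabel, hl]
    refine entanglementEntropy_eq_levelEntropy _ dyckLabel (fun v => dyckLabel (mirror (2 * n) v))
      (fun i => dyckStacks s (2 * i)) n (fun i => stackCount s s (2 * n) (2 * i))
      (append_mem_dyckWords_iff n) ?_ hc ?_
    · intro i j hij
      rw [Finset.disjoint_left]
      intro x hx hx'
      obtain ⟨l, rfl, hl⟩ := mem_dyckStacks.1 hx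
      obtain ⟨l', h, hl'⟩ := mem_dyckStacks.1 hx'
      obtain rfl := Option.some_injective _ h
      omega
    · intro i σ hσ
      rw [labelCount_comp_equiv, hc i σ hσ]
  have hU : ∀ i : ℕ, ((dyckStacks s (2 * i)).card : ℝ) *
      (stackCount s s (2 * n) (2 * i) : ℝ) ^ 2 =
      (stackCount s s (2 * n) 0 : ℝ) ^ 2 * ((2 * i + 1) * ballotWeight n i) ^ 2 := by
    intro i
    rw [card_dyckStacks, ← mul_pow, ← stackCount_self_mul_pow]
    push_cast
    ring
  have hZ : 0 < ∑ j ∈ Finset.range (n + 1), ((dyckStacks s (2 * j)).card : ℝ) *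
      (stackCount s s (2 * n) (2 * j) : ℝ) ^ 2 := by
    refine Finset.sum_pos' (fun i _ => mul_nonneg (Nat.cast_nonneg _) (sq_nonneg _))
      ⟨0, Finset.mem_range.2 (Nat.succ_pos n), ?_⟩
    rw [card_dyckStacks]
    simp only [mul_zero, pow_zero, Nat.cast_one, one_mul]
    positivity
  have h := levelEntropy_bounds (n := n) (W := fun i => ((dyckStacks s (2 * i)).card : ℝ))
    (V := fun i => (stackCount s s (2 * n) (2 * i) : ℝ) ^ 2) hs0 one_pos
    (fun i => sq_nonneg _) (fun i => by rw [card_dyckStacks]; push_cast; exact le_rfl)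
    (fun i => by rw [card_dyckStacks]; push_cast; rw [one_mul]) hZ
  simp only [hU] at h
  rw [meanHeight_const_mul n _ (pow_pos hC 2).ne', meanHeight_ballot, ← hent, Real.logb_one,
    add_zero] at h
  exact h

theorem card_reducedStacks_two_mul {s : ℕ} (hs : 0 < s) (i : ℕ) :
    ((reducedStacks (s + 1) (2 * i)).card : ℝ) = stackFactor s i * s ^ (2 * i) := by
  cases i with
  | zero => simp [reducedStacks, stackFactor]
  | succ i =>
    rw [show 2 * (i + 1) = 2 * i + 1 + 1 by ring, card_reducedStacks_succ, stackFactor,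
      if_neg (Nat.succ_ne_zero i), Nat.add_sub_cancel]
    have : (s : ℝ) ≠ 0 := by exact_mod_cast hs.ne'
    push_cast
    field_simp
    ring

theorem disjoint_reducedStacks (d : ℕ) :
    Pairwise fun i j => Disjoint (reducedStacks d (2 * i)) (reducedStacks d (2 * j)) := by
  intro i j hij
  rw [Finset.disjoint_left]
  intro l hl hl'
  have h1 := (mem_reducedStacks.1 hl).2
  have h2 := (mem_reducedStacks.1 hl').2
  omega

/-- The entropy of the pair-flip state is, up to `log₂ (n + 1) + 1`, the logarithm of `s = d - 1`
times the mean height, and this is compared with the mean height of the Dyck state. -/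
theorem pfEntropy_bounds {s : ℕ} (hs : 2 ≤ s) {n : ℕ} (hn : 1 ≤ n) :
    ∃ p : ℝ, p ≤ ((s : ℝ) / (s - 1)) ^ 2 * (ballotMoment n 3 / ballotMoment n 2 + 8) ∧
      (ballotMoment n 3 / ballotMoment n 2 - 1) +
          (ballotMoment n 3 / ballotMoment n 2 - 3) / (3 * s) ≤
        ((s : ℝ) / (s - 1)) ^ 2 * (1 + 8 * (ballotMoment n 1 / ballotMoment n 2)) * p ∧
      Real.logb 2 s * p ≤ pfEntropy (s + 1) n ∧
      pfEntropy (s + 1) n ≤ Real.logb 2 (n + 1) + 1 + Real.logb 2 s * p := by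
  have hs2 : (2 : ℝ) ≤ s := by exact_mod_cast hs
  have hs0 : (0 : ℝ) < s := by linarith
  have hC : (0 : ℝ) < stackCount s s (2 * n) 0 := by
    exact_mod_cast stackCount_pos (by omega) (by omega) (2 * n) 0 n (by omega)
  set C : ℝ := (stackCount s s (2 * n) 0 : ℝ) with hCdef
  set a : ℕ → ℝ := fun i => (stackCount (s + 1) s (2 * n) (2 * i) : ℝ) * s ^ i / C with ha
  have ha0 : ∀ i, n < i → a i = 0 := fun i hi => by
    simp [ha, stackCount_two_mul_eq_zero hi]
  have harec : ∀ i, a i = (2 * i + 1) * ballotWeight n i + a (i + 1) / s := by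
    intro i
    have h1 := stackCount_succ_left s (2 * n) (2 * i)
    have h2 := stackCount_self_mul_pow s n i
    simp only [ha]
    rw [h1, show 2 * (i + 1) = 2 * i + 2 by ring]
    push_cast
    rw [add_mul, h2, ← hCdef]
    field_simp
    ring
  have hent : pfEntropy (s + 1) n =
      levelEntropy n (fun i => ((reducedStacks (s + 1) (2 * i)).card : ℝ))
        fun i => (stackCount (s + 1) s (2 * n) (2 * i) : ℝ) ^ 2 := by
    have hc : ∀ i, ∀ σ ∈ reducedStacks (s + 1) (2 * i),
        labelCount (pfLabel (N := 2 * n)) σ = stackCount (s + 1) s (2 * n) (2 * i) := by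
      intro i σ hσ
      obtain ⟨h1, h2⟩ := mem_reducedStacks.1 hσ
      rw [labelCount_pfLabel _ _ h1, h2, Nat.add_sub_cancel]
    refine entanglementEntropy_eq_levelEntropy _ pfLabel (fun v => pfLabel (wordReverse (2 * n) v))
      (fun i => reducedStacks (s + 1) (2 * i)) n (fun i => stackCount (s + 1) s (2 * n) (2 * i))
      (append_mem_fullyReducibleWords_iff n) (disjoint_reducedStacks _) hc ?_
    intro i σ hσ
    rw [labelCount_comp_equiv, hc i σ hσ]
  have hU : ∀ i : ℕ, ((reducedStacks (s + 1) (2 * i)).card : ℝ) *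
      (stackCount (s + 1) s (2 * n) (2 * i) : ℝ) ^ 2 = C ^ 2 * (stackFactor s i * a i ^ 2) := by
    intro i
    rw [card_reducedStacks_two_mul (by omega)]
    simp only [ha]
    field_simp
    ring
  have hZ : 0 < ∑ j ∈ Finset.range (n + 1), ((reducedStacks (s + 1) (2 * j)).card : ℝ) *
      (stackCount (s + 1) s (2 * n) (2 * j) : ℝ) ^ 2 := by
    refine Finset.sum_pos' (fun i _ => mul_nonneg (Nat.cast_nonneg _) (sq_nonneg _))
      ⟨0, Finset.mem_range.2 (Nat.succ_pos n), ?_⟩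
    have h1 := stackCount_pos (r := s + 1) (s := s) (by omega) (by omega) (2 * n) 0 n (by omega)
    refine mul_pos ?_ (pow_pos (Nat.cast_pos.2 h1) 2)
    rw [card_reducedStacks_two_mul (by omega), stackFactor, if_pos rfl]
    simp
  have hκ : (0 : ℝ) < (s + 1) / s := by positivity
  have h := levelEntropy_bounds (n := n)
    (W := fun i => ((reducedStacks (s + 1) (2 * i)).card : ℝ))
    (V := fun i => (stackCount (s + 1) s (2 * n) (2 * i) : ℝ) ^ 2) hs0 hκ
    (fun i => sq_nonneg _)
    (fun i => by
      rw [card_reducedStacks_two_mul (by omega)]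
      exact le_mul_of_one_le_left (by positivity) (one_le_stackFactor hs2 i))
    (fun i => by
      rw [card_reducedStacks_two_mul (by omega)]
      exact mul_le_mul_of_nonneg_right (stackFactor_le hs2 i) (by positivity)) hZ
  simp only [hU] at h
  rw [meanHeight_const_mul n _ (pow_pos hC 2).ne', ← hent] at h
  have hlog : Real.logb 2 ((s + 1) / s) ≤ 1 := by
    rw [Real.logb_le_iff_le_rpow one_lt_two hκ, Real.rpow_one, div_le_iff₀ hs0]
    linarith
  exact ⟨_, meanHeight_pairFlip_le hs2 hn harec ha0, le_meanHeight_pairFlip hs2 hn harec ha0,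
    h.1, h.2.trans (by linarith)⟩

theorem pfSchmidtRank_eq {d : ℕ} (hd : 2 ≤ d) (n : ℕ) :
    pfSchmidtRank d n = 1 + ∑ k ∈ Finset.Icc 1 n, d * (d - 1) ^ (2 * k - 1) := by
  have hpos : ∀ σ ∈ (Finset.range (n + 1)).biUnion fun i => reducedStacks d (2 * i),
      0 < labelCount (pfLabel (N := 2 * n)) σ := by
    intro σ hσ
    simp only [Finset.mem_biUnion, Finset.mem_range] at hσ
    obtain ⟨i, hi, hσ⟩ := hσ
    obtain ⟨h1, h2⟩ := mem_reducedStacks.1 hσ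
    rw [labelCount_pfLabel _ _ h1, h2]
    exact stackCount_pos (by omega) (by omega) _ _ (n - i) (by omega)
  have h := schmidtRank_uniformSuperposition (fullyReducibleWords d (2 * n + 2 * n)) _ pfLabel
    (fun v => pfLabel (wordReverse (2 * n) v)) (append_mem_fullyReducibleWords_iff n) hpos
    (fun σ hσ => by rw [labelCount_comp_equiv]; exact hpos σ hσ)
  rw [pfSchmidtRank, pfState, h,
    Finset.card_biUnion fun i _ j _ hij => disjoint_reducedStacks d hij,
    Finset.sum_range_succ', add_comm, Finset.range_eq_Ico,
    Finset.sum_Ico_add' (fun i => (reducedStacks d (2 * i)).card) 0 n 1]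
  congr 1
  refine Finset.sum_congr (by ext; simp) fun k hk => ?_
  have hk1 := (Finset.mem_Icc.1 hk).1
  obtain ⟨j, hj⟩ : ∃ j, 2 * k = j + 1 := ⟨2 * k - 1, by omega⟩
  rw [hj, card_reducedStacks_succ, Nat.add_sub_cancel]

/-! ### Asymptotics -/

/-- An eventual inequality of sequences holds everywhere up to a constant. -/
theorem exists_const_of_eventually_le {f g : ℕ → ℝ} (h : ∀ᶠ n in atTop, f n ≤ g n) :
    ∃ K : ℝ, 0 ≤ K ∧ ∀ n, f n ≤ g n + K := by
  obtain ⟨N, hN⟩ := eventually_atTop.1 h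
  refine ⟨∑ i ∈ Finset.range N, |f i - g i|, Finset.sum_nonneg fun i _ => abs_nonneg _, fun n => ?_⟩
  rcases lt_or_ge n N with hn | hn
  · have h1 := Finset.single_le_sum (f := fun i => |f i - g i|) (fun i _ => abs_nonneg _)
      (Finset.mem_range.2 hn)
    have h2 := le_abs_self (f n - g n)
    linarith
  · have h1 : 0 ≤ ∑ i ∈ Finset.range N, |f i - g i| := Finset.sum_nonneg fun i _ => abs_nonneg _
    linarith [hN n hn]

theorem eventually_le_mul_sqrt (C : ℝ) {ε : ℝ} (hε : 0 < ε) :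
    ∀ᶠ n : ℕ in atTop, C ≤ ε * Real.sqrt n := by
  have h : Tendsto (fun n : ℕ => ε * Real.sqrt n) atTop atTop :=
    (Real.tendsto_sqrt_atTop.comp tendsto_natCast_atTop_atTop).const_mul_atTop hε
  exact h.eventually_ge_atTop C

theorem eventually_logb_add_le_mul_sqrt (C : ℝ) {ε : ℝ} (hε : 0 < ε) :
    ∀ᶠ n : ℕ in atTop, Real.logb 2 (n + 1) + C ≤ ε * Real.sqrt n := by
  have h2 : (0 : ℝ) < Real.log 2 := Real.log_pos one_lt_two
  have h := (isLittleO_log_rpow_atTop (one_half_pos (α := ℝ))).bound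
    (c := ε / 4 * Real.log 2) (by positivity)
  have ht : Tendsto (fun n : ℕ => (n : ℝ) + 1) atTop atTop :=
    tendsto_atTop_add_const_right _ _ tendsto_natCast_atTop_atTop
  filter_upwards [ht.eventually h, eventually_le_mul_sqrt C (half_pos hε),
    eventually_ge_atTop 1] with n h3 h4 h5
  have hn : (1 : ℝ) ≤ n := by exact_mod_cast h5
  rw [Real.norm_eq_abs, Real.norm_eq_abs, ← Real.sqrt_eq_rpow,
    abs_of_nonneg (Real.sqrt_nonneg _)] at h3
  have h6 : Real.sqrt ((n : ℝ) + 1) ≤ 2 * Real.sqrt n := by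
    rw [Real.sqrt_le_left (by positivity), mul_pow, Real.sq_sqrt (by linarith)]
    linarith
  have h7 : Real.logb 2 (n + 1) ≤ ε / 4 * Real.sqrt ((n : ℝ) + 1) := by
    rw [Real.logb, div_le_iff₀ h2]
    calc Real.log (n + 1) ≤ _ := le_abs_self _
      _ ≤ _ := h3
      _ = _ := by ring
  have h8 : ε / 4 * Real.sqrt ((n : ℝ) + 1) ≤ ε / 4 * (2 * Real.sqrt n) := by gcongr
  linarith

theorem one_le_logb_two {s : ℕ} (hs : 2 ≤ s) : 1 ≤ Real.logb 2 s := by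
  rw [Real.le_logb_iff_rpow_le one_lt_two (by exact_mod_cast (by omega : 0 < s)), Real.rpow_one]
  exact_mod_cast hs

theorem dyckEntropy_isTheta {s : ℕ} (hs : 2 ≤ s) :
    (fun n : ℕ => dyckEntropy s n) =Θ[atTop] fun n : ℕ => Real.sqrt (n : ℝ) := by
  have hl := one_le_logb_two hs
  constructor
  · refine IsBigO.of_bound (1 + 5 * Real.logb 2 s) ?_
    filter_upwards [eventually_ge_atTop 1, eventually_logb_add_le_mul_sqrt 0 one_pos,
      eventually_le_mul_sqrt 2 one_pos] with n h1 h2 h3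
    obtain ⟨b1, b2⟩ := dyckEntropy_bounds hs n
    obtain ⟨r1, r2, -⟩ := ballotMoment_ratio_bounds h1
    have h0 : 0 ≤ dyckEntropy s n := le_trans (mul_nonneg (by linarith) (by linarith)) b1
    rw [Real.norm_of_nonneg h0, Real.norm_of_nonneg (Real.sqrt_nonneg _)]
    have h4 : Real.logb 2 s * (ballotMoment n 3 / ballotMoment n 2 - 1) ≤
        Real.logb 2 s * (5 * Real.sqrt n) := by gcongr; linarith
    linarith
  · refine IsBigO.of_bound 4 ?_
    filter_upwards [eventually_ge_atTop 1, eventually_le_mul_sqrt 4 one_pos] with n h1 h3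
    obtain ⟨b1, b2⟩ := dyckEntropy_bounds hs n
    obtain ⟨r1, r2, -⟩ := ballotMoment_ratio_bounds h1
    have h4 : 1 * (ballotMoment n 3 / ballotMoment n 2 - 1) ≤
        Real.logb 2 s * (ballotMoment n 3 / ballotMoment n 2 - 1) := by gcongr; linarith
    rw [Real.norm_of_nonneg (Real.sqrt_nonneg _), Real.norm_of_nonneg (by linarith)]
    linarith

/-- The lower bound holds without additive constant for large `n`: the comparison of the mean
heights gains a factor `1 + 1 / (3 s)`, which absorbs all terms of order `log n`. -/
theorem eventually_le_pfEntropy {s : ℕ} (hs : 2 ≤ s) :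
    ∀ᶠ n : ℕ in atTop, (((s : ℝ) - 1) / s) ^ 2 * dyckEntropy s n ≤ pfEntropy (s + 1) n := by
  have hl := one_le_logb_two hs
  have hs2 : (2 : ℝ) ≤ s := by exact_mod_cast hs
  set l := Real.logb 2 s
  filter_upwards [eventually_ge_atTop 1,
    eventually_logb_add_le_mul_sqrt (401 * l / 81) (ε := l / (6 * s) / 81) (by positivity),
    eventually_le_mul_sqrt 2 one_pos] with n h1 h2 h3
  obtain ⟨-, b⟩ := dyckEntropy_bounds hs n
  obtain ⟨p, -, p2, p3, -⟩ := pfEntropy_bounds hs h1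
  obtain ⟨r1, r2, r3⟩ := ballotMoment_ratio_bounds h1
  have hn : (1 : ℝ) ≤ n := by exact_mod_cast h1
  have hL : 0 ≤ Real.logb 2 ((n : ℝ) + 1) := Real.logb_nonneg one_lt_two (by linarith)
  have hm0 : 0 ≤ ballotMoment n 1 / ballotMoment n 2 :=
    div_nonneg (ballotMoment_pos n 1).le (ballotMoment_pos n 2).le
  set R := ballotMoment n 3 / ballotMoment n 2
  set m := ballotMoment n 1 / ballotMoment n 2
  set q := Real.sqrt n
  set L := Real.logb 2 ((n : ℝ) + 1)
  set c := (s : ℝ) / (s - 1) with hc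
  have hq : 0 < q := by linarith
  -- `m ≤ 10 / √n` and `R ≤ 5 √n`, so `1 + 8 m ≤ 81` and `8 m (R - 1) ≤ 400`.
  have hmq : m * q ≤ 10 := (le_div_iff₀ hq).1 r3
  have hm : m ≤ 10 := by nlinarith
  have hmR : m * (R - 1) ≤ 50 := by nlinarith
  have hc0 : 0 < c := div_pos (by linarith) (by linarith)
  have hkey : (L + l * (R - 1)) * (1 + 8 * m) ≤ l * ((R - 1) + (R - 3) / (3 * s)) := by
    have e1 : L * (1 + 8 * m) ≤ 81 * L := by nlinarith
    have e2 : l * (8 * (m * (R - 1))) ≤ l * 400 := by gcongr; linarith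
    have e3 : 81 * L + 401 * l ≤ l / (6 * s) * q := by linarith
    have e4 : l / (6 * s) * q ≤ l * ((R - 3) / (3 * s)) + l := by
      have : l * ((R - 3) / (3 * s)) + l - l / (6 * s) * q =
          l * (2 * (R - q / 2) + 6 * (s - 1)) / (6 * s) := by
        field_simp
        ring
      rw [← sub_nonneg, this]
      have : 0 ≤ 2 * (R - q / 2) + 6 * ((s : ℝ) - 1) := by linarith
      positivity
    calc (L + l * (R - 1)) * (1 + 8 * m)
        = L * (1 + 8 * m) + l * (8 * (m * (R - 1))) + l * (R - 1) := by ring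
      _ ≤ l * ((R - 3) / (3 * s)) + l * (R - 1) := by linarith
      _ = _ := by ring
  have hfin : (L + l * (R - 1)) ≤ c ^ 2 * (l * p) := by
    refine le_of_mul_le_mul_right (hkey.trans ?_) (by positivity : 0 < 1 + 8 * m)
    calc l * ((R - 1) + (R - 3) / (3 * s)) ≤ l * (c ^ 2 * (1 + 8 * m) * p) := by gcongr
      _ = _ := by ring
  have hinv : (((s : ℝ) - 1) / s) ^ 2 * c ^ 2 = 1 := by
    have : (s : ℝ) - 1 ≠ 0 := by linarith
    rw [hc]
    field_simp
  calc (((s : ℝ) - 1) / s) ^ 2 * dyckEntropy s n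
      ≤ (((s : ℝ) - 1) / s) ^ 2 * (c ^ 2 * (l * p)) := by gcongr; linarith
    _ = l * p := by rw [← mul_assoc, hinv, one_mul]
    _ ≤ _ := p3

/-- The upper bound holds without additive constant for large `n`, as the mean heights are
compared with the factor `(s / (s - 1)) ^ 2`, which is less than `((s + 1) / (s - 1)) ^ 2`. -/
theorem eventually_pfEntropy_le {s : ℕ} (hs : 2 ≤ s) :
    ∀ᶠ n : ℕ in atTop, pfEntropy (s + 1) n ≤ (((s : ℝ) + 1) / (s - 1)) ^ 2 * dyckEntropy s n := by
  have hl := one_le_logb_two hs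
  have hs2 : (2 : ℝ) ≤ s := by exact_mod_cast hs
  have hs1 : 0 < (s : ℝ) - 1 := by linarith
  set l := Real.logb 2 s
  set c := ((s : ℝ) / (s - 1)) ^ 2 with hc
  set γ := (((s : ℝ) + 1) / (s - 1)) ^ 2 with hγ
  have hγc : 0 < γ - c := by
    rw [hc, hγ, sub_pos]
    gcongr
    linarith
  filter_upwards [eventually_ge_atTop 1, eventually_logb_add_le_mul_sqrt
    (1 + 9 * l * c + (γ - c) * l) (ε := (γ - c) * l / 2) (by positivity)] with n h1 h2
  obtain ⟨b, -⟩ := dyckEntropy_bounds hs n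
  obtain ⟨p, p1, -, -, p4⟩ := pfEntropy_bounds hs h1
  obtain ⟨r1, -, -⟩ := ballotMoment_ratio_bounds h1
  set R := ballotMoment n 3 / ballotMoment n 2
  have e1 : l * p ≤ l * (c * (R + 8)) := by gcongr
  have e2 : (γ - c) * l * (Real.sqrt n / 2) ≤ (γ - c) * l * R := by gcongr
  have e3 : γ * (l * (R - 1)) ≤ γ * dyckEntropy s n := by gcongr
  calc pfEntropy (s + 1) n ≤ γ * (l * (R - 1)) := by linarith
    _ ≤ _ := e3

theorem pfEntropy_isTheta_dyckEntropy {s : ℕ} (hs : 2 ≤ s) :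
    (fun n : ℕ => pfEntropy (s + 1) n) =Θ[atTop] fun n : ℕ => dyckEntropy s n := by
  have hs2 : (2 : ℝ) ≤ s := by exact_mod_cast hs
  have hs1 : 0 < (s : ℝ) - 1 := by linarith
  have hpos : ∀ᶠ n : ℕ in atTop, 0 ≤ dyckEntropy s n := by
    filter_upwards [eventually_ge_atTop 1, eventually_le_mul_sqrt 2 one_pos] with n h1 h2
    have h3 := (ballotMoment_ratio_bounds h1).1
    exact le_trans (mul_nonneg (zero_le_one.trans (one_le_logb_two hs)) (by linarith))
      (dyckEntropy_bounds hs n).1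
  have hlo := eventually_le_pfEntropy hs
  have hκ : (0 : ℝ) < ((s - 1) / s) ^ 2 := by positivity
  constructor
  · refine IsBigO.of_bound ((((s : ℝ) + 1) / (s - 1)) ^ 2) ?_
    filter_upwards [hpos, hlo, eventually_pfEntropy_le hs] with n h1 h2 h3
    rwa [Real.norm_of_nonneg h1, Real.norm_of_nonneg ((mul_nonneg hκ.le h1).trans h2)]
  · refine IsBigO.of_bound ((((s : ℝ) - 1) / s) ^ 2)⁻¹ ?_
    filter_upwards [hpos, hlo] with n h1 h2
    rw [Real.norm_of_nonneg h1, Real.norm_of_nonneg ((mul_nonneg hκ.le h1).trans h2),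
      ← div_eq_inv_mul, le_div_iff₀ hκ, mul_comm]
    exact h2

theorem pfSchmidtRank_isTheta {s : ℕ} (hs : 2 ≤ s) :
    (fun n : ℕ => (pfSchmidtRank (s + 1) n : ℝ)) =Θ[atTop] fun n : ℕ => (s : ℝ) ^ (2 * n) := by
  have hup : ∀ n, 1 + ∑ k ∈ Finset.Icc 1 n, (s + 1) * s ^ (2 * k - 1) ≤ 4 * s ^ (2 * n) := by
    intro n
    induction n with
    | zero => simp
    | succ n ih =>
      rw [Finset.sum_Icc_succ_top (by omega), ← add_assoc]
      have e : 2 * (n + 1) - 1 = 2 * n + 1 := by omega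
      rw [e]
      calc _ ≤ 4 * s ^ (2 * n) + (s + 1) * s ^ (2 * n + 1) := by gcongr
        _ = (4 + (s + 1) * s) * s ^ (2 * n) := by ring
        _ ≤ (4 * s ^ 2) * s ^ (2 * n) := by gcongr; nlinarith
        _ = _ := by ring
  have hlo : ∀ n, s ^ (2 * n) ≤ 1 + ∑ k ∈ Finset.Icc 1 n, (s + 1) * s ^ (2 * k - 1) := by
    intro n
    cases n with
    | zero => simp
    | succ n =>
      rw [Finset.sum_Icc_succ_top (by omega)]
      have e : 2 * (n + 1) - 1 = 2 * n + 1 := by omega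
      rw [e]
      calc s ^ (2 * (n + 1)) = s * s ^ (2 * n + 1) := by ring
        _ ≤ (s + 1) * s ^ (2 * n + 1) := by gcongr; omega
        _ ≤ _ := by omega
  have hrank : ∀ n, pfSchmidtRank (s + 1) n =
      1 + ∑ k ∈ Finset.Icc 1 n, (s + 1) * s ^ (2 * k - 1) := fun n =>
    pfSchmidtRank_eq (by omega) n
  constructor
  · refine IsBigO.of_bound 4 (Eventually.of_forall fun n => ?_)
    rw [Real.norm_of_nonneg (by positivity), Real.norm_of_nonneg (by positivity), hrank]
    exact_mod_cast hup n
  · refine IsBigO.of_bound 1 (Eventually.of_forall fun n => ?_)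
    rw [Real.norm_of_nonneg (by positivity), Real.norm_of_nonneg (by positivity), hrank, one_mul]
    exact_mod_cast hlo n

end PairFlip

theorem mainTheorem4 (d : ℕ) (hd : 3 ≤ d) :
    (∃ K : ℝ, ∀ n : ℕ,
      (((d : ℝ) - 2) / ((d : ℝ) - 1)) ^ 2 * PairFlip.dyckEntropy (d - 1) n - K
          ≤ PairFlip.pfEntropy d n ∧
        PairFlip.pfEntropy d n
          ≤ ((d : ℝ) / ((d : ℝ) - 2)) ^ 2 * PairFlip.dyckEntropy (d - 1) n + K) ∧
    (fun n : ℕ => PairFlip.pfEntropy d n) =Θ[atTop]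
      (fun n : ℕ => PairFlip.dyckEntropy (d - 1) n) ∧
    (fun n : ℕ => PairFlip.pfEntropy d n) =Θ[atTop] (fun n : ℕ => Real.sqrt (n : ℝ)) ∧
    (∀ n : ℕ, PairFlip.pfSchmidtRank d n
      = 1 + ∑ k ∈ Finset.Icc 1 n, d * (d - 1) ^ (2 * k - 1)) ∧
    (fun n : ℕ => (PairFlip.pfSchmidtRank d n : ℝ)) =Θ[atTop]
      (fun n : ℕ => ((d : ℝ) - 1) ^ (2 * n)) := by
  obtain ⟨s, rfl⟩ : ∃ s, d = s + 1 := ⟨d - 1, by omega⟩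
  have hs : 2 ≤ s := by omega
  have e1 : ((s + 1 : ℕ) : ℝ) - 1 = s := by push_cast; ring
  have e2 : ((s + 1 : ℕ) : ℝ) - 2 = s - 1 := by push_cast; ring
  have e3 : ((s + 1 : ℕ) : ℝ) = s + 1 := by push_cast; ring
  simp only [e1, e2]
  rw [e3, Nat.add_sub_cancel]
  have hΘ := PairFlip.pfEntropy_isTheta_dyckEntropy hs
  refine ⟨?_, hΘ, hΘ.trans (PairFlip.dyckEntropy_isTheta hs),
    fun n => PairFlip.pfSchmidtRank_eq (by omega) n, PairFlip.pfSchmidtRank_isTheta hs⟩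
  obtain ⟨K₁, hK₁, h1⟩ :=
    PairFlip.exists_const_of_eventually_le (PairFlip.eventually_le_pfEntropy hs)
  obtain ⟨K₂, hK₂, h2⟩ :=
    PairFlip.exists_const_of_eventually_le (PairFlip.eventually_pfEntropy_le hs)
  exact ⟨K₁ + K₂, fun n => ⟨by linarith [h1 n], by linarith [h2 n]⟩⟩
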